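/- Let $d\ge 2$, $S^1=\mathbb R/2\pi\mathbb Z$, and let $\mathcal I^2(S^1,\mathbb R^d)=\{c\in H^2(S^1,\mathbb R^d): c'(\theta)\neq 0 \text{ for all }\theta\}$, an open subset of the Hilbert space $H^2(S^1,\mathbb R^d)$ with norm $\|h\|^2=\int_{S^1}|h|^2+|h''|^2\,d\theta$. For $c\in\mathcal I^2(S^1,\mathbb R^d)$ write $D_s h=h'/|c'|$, $ds=|c'|\,d\theta$ and $\ell_c=\int_{S^1}ds$. A second order length-weighted Sobolev metric is $$G_c(h,k)=\int_{S^1}\sum_{j=0}^{2}a_j(\ell_c)\,\langle D_s^jh,D_s^jk\rangle\,ds ,\qquad h,k\in H^2(S^1,\mathbb R^d),$$ with smooth coefficients $a_j:(0,\infty)\to[0,\infty)$ such that $a_0>0$ and $a_2>0$. Its geodesic distance is the infimum of $\int_0^1\sqrt{G_{c(t)}(\partial_tc,\partial_tc)}\,dt$ over all $C^1$ paths $t\mapsto c(t)$ in $\mathcal I^2(S^1,\mathbb R^d)$ joining two curves ($+\infty$ if there is none); $G$ is called metrically complete if $\mathcal I^2(S^1,\mathbb R^d)$ with the geodesic distance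 is complete. Put $$I_{0,k}=\int_0^1r^{1/2-k}\sqrt{a_k(r)}\,dr,\qquad I_{\infty,k}=\int_1^\infty r^{1/2-k}\sqrt{a_k(r)}\,dr .$$ For $p,q\in\mathbb R$ consider the metric $$G_c(h,k)=\int_{S^1}\ell_c^{\,q}\langle h,k\rangle+\ell_c^{\,p}\langle D_s^2h,D_s^2k\rangle\,ds .$$ (1) If $q=-3$ and $p<1$, this metric is not metrically complete; moreover, there is a sequence $(c_n)$ in $\mathcal I^2(S^1,\mathbb R^d)$ that is Cauchy for the geodesic distance, has no limit in $\mathcal I^2(S^1,\mathbb R^d)$ for the geodesic distance, and satisfies $\ell_{c_n}\to\infty$. (2) If $q=-3$ and $p>1$, this metric is not metrically complete; moreover, there is a sequence $(c_n)$ in $\mathcal I^2(S^1,\mathbb R^d)$ that is Cauchy for the geodesic distance, has no limit in $\mathcal I^2(S^1,\mathbb R^d)$ for the geodesic distance, and satisfies $\ell_{c_n}\to 0$. (3) Not every second order length-weighted Sobolev metric on $\mathcal I^2(S^1,\mathbb R^d)$ with $\max_{1\le k\le 2}I_{0,k}=\infty$ and $\max_{0\le k\le 2}I_{\infty,k}=\infty$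 is metrically complete, and not every such metric with $\max_{0\le k\le 2}I_{0,k}=\infty$ and $\max_{1\le k\le 2}I_{\infty,k}=\infty$ is metrically complete. -/

import Mathlib

open Set Filter MeasureTheory Topology
open scoped ENNReal Manifold ContDiff

noncomputable section

namespace SobolevCurves

/-- The Euclidean space `ℝ^d`. -/
abbrev Euc (d : ℕ) : Type := EuclideanSpace ℝ (Fin d)

/-- `f : ℝ → ℝ^d` is (the continuous representative of) an element of `H²(S¹, ℝ^d)`, with
`S¹ = ℝ / 2πℤ`: it is `2π`-periodic and continuously differentiable, and `f'` is the primitive of a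
square integrable function. -/
structure IsSobolevTwo {d : ℕ} (f : ℝ → Euc d) : Prop where
  periodic : Function.Periodic f (2 * Real.pi)
  contDiff : ContDiff ℝ 1 f
  primitive : ∃ g : ℝ → Euc d, MemLp g 2 (volume.restrict (Ioc 0 (2 * Real.pi))) ∧
    ∀ t ∈ Icc 0 (2 * Real.pi), deriv f t = deriv f 0 + ∫ s in (0 : ℝ)..t, g s

variable {d : ℕ}

theorem two_pi_nonneg : (0 : ℝ) ≤ 2 * Real.pi := by positivity

theorem MemLp.intervalIntegrable_of_mem {g : ℝ → Euc d}
    (hg : MemLp g 2 (volume.restrict (Ioc 0 (2 * Real.pi)))) {a b : ℝ}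
    (ha : a ∈ Icc 0 (2 * Real.pi)) (hb : b ∈ Icc 0 (2 * Real.pi)) :
    IntervalIntegrable g volume a b := by
  have h : IntervalIntegrable g volume 0 (2 * Real.pi) := by
    rw [intervalIntegrable_iff_integrableOn_Ioc_of_le two_pi_nonneg]
    exact hg.integrable (by norm_num)
  refine h.mono_set ?_
  rw [uIcc_of_le two_pi_nonneg]
  exact uIcc_subset_Icc ha hb

theorem isSobolevTwo_zero : IsSobolevTwo (0 : ℝ → Euc d) where
  periodic := fun _ => rfl
  contDiff := contDiff_const
  primitive := ⟨0, MemLp.zero, fun t _ => by simp⟩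

theorem IsSobolevTwo.add {f₁ f₂ : ℝ → Euc d} (h₁ : IsSobolevTwo f₁) (h₂ : IsSobolevTwo f₂) :
    IsSobolevTwo (f₁ + f₂) where
  periodic := h₁.periodic.add h₂.periodic
  contDiff := h₁.contDiff.add h₂.contDiff
  primitive := by
    obtain ⟨g₁, hg₁, e₁⟩ := h₁.primitive
    obtain ⟨g₂, hg₂, e₂⟩ := h₂.primitive
    have hd : ∀ t, deriv (f₁ + f₂) t = deriv f₁ t + deriv f₂ t := fun t =>
      deriv_add (h₁.contDiff.differentiable one_ne_zero t)
        (h₂.contDiff.differentiable one_ne_zero t)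
    refine ⟨g₁ + g₂, hg₁.add hg₂, fun t ht => ?_⟩
    have h0 : (0 : ℝ) ∈ Icc 0 (2 * Real.pi) := ⟨le_rfl, two_pi_nonneg⟩
    have hi : ∫ s in (0 : ℝ)..t, (g₁ + g₂) s
        = (∫ s in (0 : ℝ)..t, g₁ s) + ∫ s in (0 : ℝ)..t, g₂ s :=
      intervalIntegral.integral_add (MemLp.intervalIntegrable_of_mem hg₁ h0 ht)
        (MemLp.intervalIntegrable_of_mem hg₂ h0 ht)
    rw [hd, hd, e₁ t ht, e₂ t ht, hi]
    abel

theorem IsSobolevTwo.smul (r : ℝ) {f : ℝ → Euc d} (h : IsSobolevTwo f) :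
    IsSobolevTwo (r • f) where
  periodic := fun t => by simp [h.periodic t]
  contDiff := contDiff_const.smul h.contDiff
  primitive := by
    obtain ⟨g, hg, e⟩ := h.primitive
    refine ⟨r • g, hg.const_smul r, fun t ht => ?_⟩
    have hd : ∀ t, deriv (r • f) t = r • deriv f t := fun t =>
      deriv_const_smul r (h.contDiff.differentiable one_ne_zero t)
    rw [hd, hd, e t ht]
    simp

/-- The linear space underlying `H²(S¹, ℝ^d)`. -/
def sobolevTwoSubmodule (d : ℕ) : Submodule ℝ (ℝ → Euc d) where
  carrier := {f | IsSobolevTwo f}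
  zero_mem' := isSobolevTwo_zero
  add_mem' := fun h₁ h₂ => h₁.add h₂
  smul_mem' := fun r _ h => h.smul r

/-- The Sobolev space `H²(S¹, ℝ^d)`. -/
def SobolevTwo (d : ℕ) : Type := sobolevTwoSubmodule d

namespace SobolevTwo

instance : AddCommGroup (SobolevTwo d) := inferInstanceAs (AddCommGroup (sobolevTwoSubmodule d))

instance : Module ℝ (SobolevTwo d) := inferInstanceAs (Module ℝ (sobolevTwoSubmodule d))

instance : FunLike (SobolevTwo d) ℝ (Euc d) where
  coe := Subtype.val (p := (· ∈ sobolevTwoSubmodule d))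
  coe_injective := Subtype.val_injective

theorem isSobolevTwo (f : SobolevTwo d) : IsSobolevTwo (f : ℝ → Euc d) := f.2

theorem ext_of {f g : SobolevTwo d} (h : ∀ t, f t = g t) : f = g := DFunLike.ext f g h

theorem coe_add (f g : SobolevTwo d) : ((f + g : SobolevTwo d) : ℝ → Euc d) = ⇑f + ⇑g := rfl

theorem coe_sub (f g : SobolevTwo d) : ((f - g : SobolevTwo d) : ℝ → Euc d) = ⇑f - ⇑g := rfl

theorem coe_smul (r : ℝ) (f : SobolevTwo d) : ((r • f : SobolevTwo d) : ℝ → Euc d) = r • ⇑f := rfl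

theorem ae_hasDerivAt (f : SobolevTwo d) : ∃ g : ℝ → Euc d,
    MemLp g 2 (volume.restrict (Ioc 0 (2 * Real.pi))) ∧
    (∀ t ∈ Icc 0 (2 * Real.pi), deriv f t = deriv f 0 + ∫ s in (0 : ℝ)..t, g s) ∧
    ∀ᵐ t ∂(volume.restrict (Ioc 0 (2 * Real.pi))), HasDerivAt (deriv f) (g t) t := by
  obtain ⟨g, hg, e⟩ := f.isSobolevTwo.primitive
  refine ⟨g, hg, e, ?_⟩
  have h0 : (0 : ℝ) ∈ Icc 0 (2 * Real.pi) := ⟨le_rfl, two_pi_nonneg⟩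
  have h1 : (2 * Real.pi) ∈ Icc 0 (2 * Real.pi) := ⟨two_pi_nonneg, le_rfl⟩
  have hI := MemLp.intervalIntegrable_of_mem hg h0 h1
  have key := hI.ae_hasDerivAt_integral
  have hne : ∀ᵐ t : ℝ, t ≠ 2 * Real.pi := by
    simp [ae_iff]
  rw [ae_restrict_iff' measurableSet_Ioc]
  filter_upwards [key, hne] with t ht htne htm
  have htI : t ∈ Ioo 0 (2 * Real.pi) := ⟨htm.1, lt_of_le_of_ne htm.2 htne⟩
  have h2 := ht (by rw [uIcc_of_le two_pi_nonneg]; exact Ioo_subset_Icc_self htI) 0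
    (by rw [uIcc_of_le two_pi_nonneg]; exact h0)
  have h3 : HasDerivAt (fun x => deriv f 0 + ∫ s in (0 : ℝ)..x, g s) (g t) t :=
    h2.const_add _
  have h4 : deriv f =ᶠ[𝓝 t] (fun x => deriv f 0 + ∫ s in (0 : ℝ)..x, g s) := by
    filter_upwards [Ioo_mem_nhds htI.1 htI.2] with x hx using e x (Ioo_subset_Icc_self hx)
  exact h3.congr_of_eventuallyEq h4

theorem ae_differentiableAt (f : SobolevTwo d) :
    ∀ᵐ t ∂(volume.restrict (Ioc 0 (2 * Real.pi))), DifferentiableAt ℝ (deriv f) t :=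
  let ⟨_, _, _, h⟩ := f.ae_hasDerivAt
  h.mono fun _ h => h.differentiableAt

theorem memLp_deriv_deriv (f : SobolevTwo d) :
    MemLp (deriv (deriv f)) 2 (volume.restrict (Ioc 0 (2 * Real.pi))) := by
  obtain ⟨g, hg, -, h⟩ := f.ae_hasDerivAt
  exact hg.ae_eq (h.mono fun _ ht => ht.deriv.symm)

theorem memLp_self (f : SobolevTwo d) :
    MemLp f 2 (volume.restrict (Ioc 0 (2 * Real.pi))) := by
  have hc : Continuous f := f.isSobolevTwo.contDiff.continuous
  obtain ⟨C, hC⟩ := isCompact_Icc.exists_bound_of_continuousOn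
    (hc.continuousOn (s := Icc 0 (2 * Real.pi)))
  refine MemLp.of_bound hc.aestronglyMeasurable C ?_
  rw [ae_restrict_iff' measurableSet_Ioc]
  filter_upwards with t ht using hC t (Ioc_subset_Icc_self ht)

theorem deriv_deriv_add (f g : SobolevTwo d) :
    deriv (deriv (f + g : SobolevTwo d)) =ᵐ[volume.restrict (Ioc 0 (2 * Real.pi))]
      deriv (deriv f) + deriv (deriv g) := by
  have hd : deriv ((f + g : SobolevTwo d) : ℝ → Euc d) = deriv f + deriv g := by
    funext t
    exact deriv_add (f.isSobolevTwo.contDiff.differentiable one_ne_zero t)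
      (g.isSobolevTwo.contDiff.differentiable one_ne_zero t)
  rw [hd]
  filter_upwards [f.ae_differentiableAt, g.ae_differentiableAt] with t hf hg
  exact deriv_add hf hg

theorem deriv_deriv_smul (r : ℝ) (f : SobolevTwo d) :
    deriv (deriv (r • ⇑f)) = r • deriv (deriv f) := by
  have hd : deriv (r • ⇑f) = r • deriv f := by
    funext t
    exact deriv_const_smul_field r _
  rw [hd]
  funext t
  exact deriv_const_smul_field r _

theorem integrable_inner_of_memLp {u v : ℝ → Euc d} {μ : Measure ℝ} (hu : MemLp u 2 μ)
    (hv : MemLp v 2 μ) : Integrable (fun t => inner ℝ (u t) (v t)) μ := by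
  refine (hu.norm.integrable_mul hv.norm).mono' (hu.1.inner hv.1) ?_
  filter_upwards with t using norm_inner_le_norm _ _

theorem integrable_inner_add (f g : SobolevTwo d) :
    Integrable (fun t => inner ℝ (f t) (g t)
      + inner ℝ (deriv (deriv f) t) (deriv (deriv g) t))
      (volume.restrict (Ioc 0 (2 * Real.pi))) :=
  (integrable_inner_of_memLp f.memLp_self g.memLp_self).add
    (integrable_inner_of_memLp f.memLp_deriv_deriv g.memLp_deriv_deriv)

/-- The inner product `∫ ⟨f, g⟩ + ⟨f'', g''⟩ dθ` on `H²(S¹, ℝ^d)`. -/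
@[reducible] def core (d : ℕ) : InnerProductSpace.Core ℝ (SobolevTwo d) where
  inner f g := ∫ t in (0 : ℝ)..(2 * Real.pi),
    (inner ℝ (f t) (g t) + inner ℝ (deriv (deriv f) t) (deriv (deriv g) t))
  conj_inner_symm f g := by
    simp [real_inner_comm]
  re_inner_nonneg f := by
    refine intervalIntegral.integral_nonneg two_pi_nonneg fun t _ => ?_
    exact add_nonneg real_inner_self_nonneg real_inner_self_nonneg
  add_left f₁ f₂ g := by
    simp only [intervalIntegral.integral_of_le two_pi_nonneg]
    rw [← integral_add (integrable_inner_add f₁ g) (integrable_inner_add f₂ g)]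
    refine integral_congr_ae ?_
    filter_upwards [deriv_deriv_add f₁ f₂] with t ht
    rw [ht]
    simp only [coe_add, Pi.add_apply, inner_add_left]
    ring
  smul_left f g r := by
    simp only [coe_smul, deriv_deriv_smul, Pi.smul_apply, inner_smul_left, ← mul_add]
    rw [intervalIntegral.integral_const_mul]
  definite f hf := by
    have hf' : ∫ t in Ioc 0 (2 * Real.pi),
        (inner ℝ (f t) (f t) + inner ℝ (deriv (deriv f) t) (deriv (deriv f) t)) = 0 := by
      rw [← intervalIntegral.integral_of_le two_pi_nonneg]
      exact hf
    have hc : Continuous f := f.isSobolevTwo.contDiff.continuous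
    rw [integral_eq_zero_iff_of_nonneg
      (fun t => add_nonneg real_inner_self_nonneg real_inner_self_nonneg)
      (integrable_inner_add f f)] at hf'
    have hae : (f : ℝ → Euc d) =ᵐ[volume.restrict (Ioc 0 (2 * Real.pi))] 0 := by
      filter_upwards [hf'] with t ht
      have h1 : (0 : ℝ) ≤ inner ℝ (f t) (f t) := real_inner_self_nonneg
      have h2 : (0 : ℝ) ≤ inner ℝ (deriv (deriv f) t) (deriv (deriv f) t) :=
        real_inner_self_nonneg
      have h3 : inner ℝ (f t) (f t) + inner ℝ (deriv (deriv f) t) (deriv (deriv f) t)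
        = (0 : ℝ) := ht
      exact inner_self_eq_zero.1 (le_antisymm (by linarith) h1 : inner ℝ (f t) (f t) = (0 : ℝ))
    have hon : EqOn (f : ℝ → Euc d) 0 (Ioo 0 (2 * Real.pi)) := by
      have hae' : (f : ℝ → Euc d) =ᵐ[volume.restrict (Ioo 0 (2 * Real.pi))] 0 :=
        ae_restrict_of_ae_restrict_of_subset Ioo_subset_Ioc_self hae
      exact Measure.eqOn_open_of_ae_eq hae' isOpen_Ioo hc.continuousOn continuousOn_const
    have hon' : EqOn (f : ℝ → Euc d) 0 (Icc 0 (2 * Real.pi)) := by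
      have h := hon.closure hc continuous_const
      rwa [closure_Ioo Real.two_pi_pos.ne] at h
    refine ext_of fun t => ?_
    obtain ⟨s, hs, hst⟩ := f.isSobolevTwo.periodic.exists_mem_Ico₀ Real.two_pi_pos t
    have h := hon' (Ico_subset_Icc_self hs)
    exact hst.trans h

instance : NormedAddCommGroup (SobolevTwo d) := (core d).toNormedAddCommGroup

instance : InnerProductSpace ℝ (SobolevTwo d) := InnerProductSpace.ofCore (core d).toCore

theorem norm_sq_eq (f : SobolevTwo d) : ‖f‖ ^ 2
    = ∫ t in (0 : ℝ)..(2 * Real.pi), (‖f t‖ ^ 2 + ‖deriv (deriv f) t‖ ^ 2) := by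
  rw [← real_inner_self_eq_norm_sq]
  change ∫ t in (0 : ℝ)..(2 * Real.pi),
    (inner ℝ (f t) (f t) + inner ℝ (deriv (deriv f) t) (deriv (deriv f) t)) = _
  simp only [real_inner_self_eq_norm_sq]

theorem deriv_periodic (f : SobolevTwo d) : Function.Periodic (deriv f) (2 * Real.pi) := by
  intro x
  have hfun : (fun y => f (y + 2 * Real.pi)) = (f : ℝ → Euc d) :=
    funext f.isSobolevTwo.periodic
  rw [← deriv_comp_add_const, hfun]

/-- The Sobolev embedding `H²(S¹) ⊆ C¹(S¹)`, for the derivative. -/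
theorem norm_deriv_le (f : SobolevTwo d) (t : ℝ) :
    ‖deriv f t‖ ≤ √(2 * Real.pi) * ‖f‖ := by
  have hp : (0 : ℝ) < 2 * Real.pi := Real.two_pi_pos
  obtain ⟨g, hg, e, hgd⟩ := f.ae_hasDerivAt
  have hgae := hgd.mono fun _ ht => ht.deriv
  have h0 : (0 : ℝ) ∈ Icc 0 (2 * Real.pi) := ⟨le_rfl, two_pi_nonneg⟩
  have h1 : (2 * Real.pi) ∈ Icc 0 (2 * Real.pi) := ⟨two_pi_nonneg, le_rfl⟩
  have hC : ContDiff ℝ 1 (f : ℝ → Euc d) := f.isSobolevTwo.contDiff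
  have hcd : Continuous (deriv f) := hC.continuous_deriv le_rfl
  set A : ℝ := ∫ s in (0 : ℝ)..(2 * Real.pi), ‖g s‖ with hA
  have hgn : IntervalIntegrable (fun s => ‖g s‖) volume 0 (2 * Real.pi) :=
    (MemLp.intervalIntegrable_of_mem hg h0 h1).norm
  have hgsq : IntervalIntegrable (fun s => ‖g s‖ ^ 2) volume 0 (2 * Real.pi) := by
    rw [intervalIntegrable_iff_integrableOn_Ioc_of_le two_pi_nonneg]
    exact hg.integrable_norm_pow (by norm_num)
  -- oscillation of the derivative
  have hosc : ∀ x ∈ Icc 0 (2 * Real.pi), ∀ y ∈ Icc 0 (2 * Real.pi),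
      ‖deriv f x - deriv f y‖ ≤ A := by
    intro x hx y hy
    rw [e x hx, e y hy, add_sub_add_left_eq_sub,
      intervalIntegral.integral_interval_sub_left (MemLp.intervalIntegrable_of_mem hg h0 hx)
        (MemLp.intervalIntegrable_of_mem hg h0 hy)]
    refine intervalIntegral.norm_integral_le_abs_integral_norm.trans ?_
    rw [hA, ← abs_of_nonneg (intervalIntegral.integral_nonneg two_pi_nonneg
      (fun s _ => norm_nonneg (g s)))]
    refine intervalIntegral.abs_integral_mono_interval ?_ ?_ hgn
    · rw [uIoc_of_le two_pi_nonneg]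
      intro z hz
      rw [uIoc, mem_Ioc] at hz
      exact ⟨lt_of_le_of_lt (le_min hy.1 hx.1) hz.1, hz.2.trans (max_le hy.2 hx.2)⟩
    · filter_upwards with s using norm_nonneg _
  have hmean : ∫ s in (0 : ℝ)..(2 * Real.pi), deriv f s = 0 := by
    rw [intervalIntegral.integral_deriv_eq_sub
      (fun x _ => hC.differentiable one_ne_zero x) (hcd.intervalIntegrable _ _)]
    have := f.isSobolevTwo.periodic 0
    rw [zero_add] at this
    rw [this, sub_self]
  have hAbound : ∀ x ∈ Icc 0 (2 * Real.pi), ‖deriv f x‖ ≤ A := by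
    intro x hx
    have h2 : ∫ s in (0 : ℝ)..(2 * Real.pi), (deriv f x - deriv f s)
        = (2 * Real.pi) • deriv f x := by
      rw [intervalIntegral.integral_sub (by simp) (hcd.intervalIntegrable _ _), hmean]
      simp
    have h3 : ‖∫ s in (0 : ℝ)..(2 * Real.pi), (deriv f x - deriv f s)‖
        ≤ A * |2 * Real.pi - 0| := by
      refine intervalIntegral.norm_integral_le_of_norm_le_const fun s hs => ?_
      rw [uIoc_of_le two_pi_nonneg] at hs
      exact hosc x hx s (Ioc_subset_Icc_self hs)
    rw [h2, norm_smul, sub_zero, abs_of_pos hp, Real.norm_eq_abs, abs_of_pos hp,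
      mul_comm A] at h3
    exact le_of_mul_le_mul_left h3 hp
  have hA0 : 0 ≤ A := intervalIntegral.integral_nonneg two_pi_nonneg (fun s _ => norm_nonneg _)
  -- Cauchy--Schwarz
  have hCS : A ^ 2 ≤ 2 * Real.pi * ∫ s in (0 : ℝ)..(2 * Real.pi), ‖g s‖ ^ 2 := by
    have h4 : 0 ≤ ∫ s in (0 : ℝ)..(2 * Real.pi),
        (2 * Real.pi * ‖g s‖ ^ 2 - 2 * A * ‖g s‖ + A ^ 2 / (2 * Real.pi)) := by
      refine intervalIntegral.integral_nonneg two_pi_nonneg fun s _ => ?_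
      have : 2 * Real.pi * ‖g s‖ ^ 2 - 2 * A * ‖g s‖ + A ^ 2 / (2 * Real.pi)
          = (2 * Real.pi * ‖g s‖ - A) ^ 2 / (2 * Real.pi) := by
        field_simp
        ring
      rw [this]
      positivity
    rw [intervalIntegral.integral_add ((hgsq.const_mul _).sub (hgn.const_mul _)) (by simp),
      intervalIntegral.integral_sub (hgsq.const_mul _) (hgn.const_mul _),
      intervalIntegral.integral_const_mul, intervalIntegral.integral_const_mul, ← hA,
      intervalIntegral.integral_const, sub_zero, smul_eq_mul,
      mul_div_cancel₀ _ hp.ne'] at h4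
    nlinarith
  have hnorm : ∫ s in (0 : ℝ)..(2 * Real.pi), ‖g s‖ ^ 2 ≤ ‖f‖ ^ 2 := by
    rw [norm_sq_eq, intervalIntegral.integral_of_le two_pi_nonneg,
      intervalIntegral.integral_of_le two_pi_nonneg]
    refine integral_mono_ae (hg.integrable_norm_pow (by norm_num)) ?_ ?_
    · simpa only [real_inner_self_eq_norm_sq] using integrable_inner_add f f
    · filter_upwards [hgae] with s hs
      rw [hs]
      exact le_add_of_nonneg_left (by positivity)
  have hfin : A ≤ √(2 * Real.pi) * ‖f‖ := by
    refine le_of_sq_le_sq ?_ (by positivity)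
    rw [mul_pow, Real.sq_sqrt two_pi_nonneg]
    exact hCS.trans (mul_le_mul_of_nonneg_left hnorm two_pi_nonneg)
  obtain ⟨s, hs, hst⟩ := f.deriv_periodic.exists_mem_Ico₀ hp t
  rw [hst]
  exact (hAbound s (Ico_subset_Icc_self hs)).trans hfin

theorem isOpen_immersions (d : ℕ) : IsOpen {c : SobolevTwo d | ∀ t, deriv c t ≠ 0} := by
  rw [Metric.isOpen_iff]
  intro c hc
  have hcd : Continuous (deriv c) := c.isSobolevTwo.contDiff.continuous_deriv le_rfl
  obtain ⟨t₀, -, ht₀⟩ := isCompact_Icc.exists_isMinOn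
    (nonempty_Icc.2 two_pi_nonneg) hcd.norm.continuousOn
  have hm : 0 < ‖deriv c t₀‖ := norm_pos_iff.2 (hc t₀)
  have hs : 0 < √(2 * Real.pi) := Real.sqrt_pos.2 Real.two_pi_pos
  refine ⟨‖deriv c t₀‖ / √(2 * Real.pi), by positivity, fun b hb t hbt => ?_⟩
  obtain ⟨s, hs', hst⟩ := c.deriv_periodic.exists_mem_Ico₀ Real.two_pi_pos t
  have h1 : ‖deriv c t₀‖ ≤ ‖deriv c t‖ := by
    rw [hst]
    exact ht₀ (Ico_subset_Icc_self hs')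
  have h2 := norm_deriv_le (b - c) t
  have h3 : deriv ((b - c : SobolevTwo d) : ℝ → Euc d) t = deriv b t - deriv c t :=
    deriv_sub (b.isSobolevTwo.contDiff.differentiable one_ne_zero t)
      (c.isSobolevTwo.contDiff.differentiable one_ne_zero t)
  rw [h3, hbt, zero_sub, norm_neg] at h2
  rw [Metric.mem_ball, dist_eq_norm, lt_div_iff₀ hs] at hb
  linarith

end SobolevTwo

/-- The space `𝓘²(S¹, ℝ^d)` of immersions of class `H²`, an open subset of `H²(S¹, ℝ^d)`. -/
def SobolevImmersion (d : ℕ) : TopologicalSpace.Opens (SobolevTwo d) :=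
  ⟨{c | ∀ t, deriv c t ≠ 0}, SobolevTwo.isOpen_immersions d⟩

/-- Arc length derivative `D_s h = h' / |c'|` along the curve `c`. -/
def arcDeriv (c h : ℝ → Euc d) : ℝ → Euc d := fun θ => ‖deriv c θ‖⁻¹ • deriv h θ

/-- Length `ℓ_c = ∫ |c'| dθ` of a closed curve. -/
def curveLength (c : ℝ → Euc d) : ℝ := ∫ θ in (0 : ℝ)..(2 * Real.pi), ‖deriv c θ‖

/-- The second order length-weighted metric
`G_c(h, k) = ∫ ∑_{j ≤ 2} a_j(ℓ_c) ⟨D_s^j h, D_s^j k⟩ ds`, where `ds = |c'| dθ`. -/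
def sobolevMetric (a : Fin 3 → ℝ → ℝ) (c h k : ℝ → Euc d) : ℝ :=
  ∫ θ in (0 : ℝ)..(2 * Real.pi),
    (∑ j : Fin 3, a j (curveLength c) *
      inner ℝ ((arcDeriv c)^[j] h θ) ((arcDeriv c)^[j] k θ)) * ‖deriv c θ‖

/-- The norm `√(G_c(h, h))` on the tangent space `T_c 𝓘² = H²(S¹, ℝ^d)`. -/
@[reducible] def tangentENorm (a : Fin 3 → ℝ → ℝ) (c : SobolevImmersion d) :
    ENorm (TangentSpace 𝓘(ℝ, SobolevTwo d) c) where
  enorm := fun h : SobolevTwo d =>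
    ENNReal.ofReal (√(sobolevMetric a (c : SobolevTwo d) h h))

theorem sobolevMetric_smul (a : Fin 3 → ℝ → ℝ) (c h : ℝ → Euc d) (r : ℝ) :
    sobolevMetric a c (r • h) (r • h) = r ^ 2 * sobolevMetric a c h h := by
  have hs : ∀ h : ℝ → Euc d, arcDeriv c (r • h) = r • arcDeriv c h := by
    intro h
    funext θ
    have : deriv (r • h) θ = r • deriv h θ := deriv_const_smul_field r _
    simp only [arcDeriv, Pi.smul_apply, this]
    rw [smul_comm]
  have hj : ∀ j : ℕ, (arcDeriv c)^[j] (r • h) = r • (arcDeriv c)^[j] h := by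
    intro j
    induction j with
    | zero => rfl
    | succ j ih => rw [Function.iterate_succ_apply', Function.iterate_succ_apply', ih, hs]
  unfold sobolevMetric
  rw [← intervalIntegral.integral_const_mul]
  congr 1
  funext θ
  simp only [hj, Pi.smul_apply, inner_smul_left, inner_smul_right, Finset.sum_mul, Finset.mul_sum]
  refine Finset.sum_congr rfl fun j _ => ?_
  simp
  ring

theorem tangentENorm_smul (a : Fin 3 → ℝ → ℝ) (c : SobolevImmersion d) :
    letI := tangentENorm a c
    ENormSMulClass ℝ (TangentSpace 𝓘(ℝ, SobolevTwo d) c) := by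
  let := tangentENorm a c
  refine ⟨fun r h => ?_⟩
  let u : SobolevTwo d := h
  change ENNReal.ofReal (√(sobolevMetric a (c : SobolevTwo d) (r • ⇑u) (r • ⇑u)))
    = ‖r‖ₑ * ENNReal.ofReal (√(sobolevMetric a (c : SobolevTwo d) u u))
  rw [sobolevMetric_smul, Real.sqrt_mul (sq_nonneg r), Real.sqrt_sq_eq_abs,
    ENNReal.ofReal_mul (abs_nonneg r), ← Real.norm_eq_abs, ofReal_norm]

/-- The geodesic distance of the metric with coefficients `a`: the infimum of
`∫ √(G_{c(t)}(∂_t c, ∂_t c)) dt` over the `C¹` paths in `𝓘²(S¹, ℝ^d)` between the two curves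
(infinite if there is no such path). -/
def geodesicEDist (a : Fin 3 → ℝ → ℝ) (c₀ c₁ : SobolevImmersion d) : ℝ≥0∞ :=
  letI := fun c : SobolevImmersion d => tangentENorm a c
  Manifold.riemannianEDist 𝓘(ℝ, SobolevTwo d) c₀ c₁

/-- The set `𝓘²(S¹, ℝ^d)`, to be equipped with the geodesic distance. -/
def GeodesicSpace (d : ℕ) (_ : Fin 3 → ℝ → ℝ) : Type := SobolevImmersion d

namespace GeodesicSpace

variable {a : Fin 3 → ℝ → ℝ}

/-- A point of the space, as an immersion. -/
def toImmersion (c : GeodesicSpace d a) : SobolevImmersion d := c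

/-- The curve, as a `2π`-periodic function on the line, of a point of the space. -/
def curve (c : GeodesicSpace d a) : ℝ → Euc d :=
  (c.toImmersion : SobolevTwo d)

instance : PseudoEMetricSpace (GeodesicSpace d a) where
  edist c₀ c₁ := geodesicEDist (d := d) a c₀ c₁
  edist_self c := by
    let := fun c : SobolevImmersion d => tangentENorm a c
    have := fun c : SobolevImmersion d => tangentENorm_smul a c
    exact Manifold.riemannianEDist_self
  edist_comm c₀ c₁ := by
    let := fun c : SobolevImmersion d => tangentENorm a c
    have := fun c : SobolevImmersion d => tangentENorm_smul a c
    exact Manifold.riemannianEDist_comm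
  edist_triangle c₀ c₁ c₂ := by
    let := fun c : SobolevImmersion d => tangentENorm a c
    have := fun c : SobolevImmersion d => tangentENorm_smul a c
    exact Manifold.riemannianEDist_triangle

end GeodesicSpace

/-- The coefficients of a second order length-weighted Sobolev metric: smooth nonnegative functions
on `(0, ∞)`, the first and the last of which are positive. -/
structure IsLengthWeight (a : Fin 3 → ℝ → ℝ) : Prop where
  smooth : ∀ j, ContDiffOn ℝ ∞ (a j) (Ioi 0)
  nonneg : ∀ j, ∀ r > 0, 0 ≤ a j r
  pos_zero : ∀ r > 0, 0 < a 0 r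
  pos_two : ∀ r > 0, 0 < a 2 r

/-- `I_{0,k} = ∫_0^1 r^{1/2-k} √(a_k(r)) dr`, in `[0, ∞]`. -/
def integralZero (a : Fin 3 → ℝ → ℝ) (k : Fin 3) : ℝ≥0∞ :=
  ∫⁻ r in Ioo (0 : ℝ) 1, ENNReal.ofReal (r ^ (1 / 2 - ((k : ℕ) : ℝ)) * √(a k r))

/-- `I_{∞,k} = ∫_1^∞ r^{1/2-k} √(a_k(r)) dr`, in `[0, ∞]`. -/
def integralInfty (a : Fin 3 → ℝ → ℝ) (k : Fin 3) : ℝ≥0∞ :=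
  ∫⁻ r in Ioi (1 : ℝ), ENNReal.ofReal (r ^ (1 / 2 - ((k : ℕ) : ℝ)) * √(a k r))

/-- The coefficients `a_0(ℓ) = ℓ^q`, `a_1(ℓ) = 0`, `a_2(ℓ) = ℓ^p`, for which
`G_c(h, k) = ∫ ℓ_c^q ⟨h, k⟩ + ℓ_c^p ⟨D_s² h, D_s² k⟩ ds`. -/
def powerWeight (q p : ℝ) : Fin 3 → ℝ → ℝ :=
  ![fun r => r ^ q, fun _ => 0, fun r => r ^ p]

end SobolevCurves

end

/-!
The same weight `powerWeight (-3) p` with `p ≠ 1` serves all parts: the geodesic space is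
incomplete for `p < 1` because curves escape to infinite length, and for `p > 1` because they
shrink to length zero, each time within finite distance. Scaling a fixed curve does not do this,
since the zeroth order term of weight `ℓ ^ (-3)` makes the distance logarithmic in the length. The
escaping curves must grow or shrink while staying inside a region much smaller than their length.

The curves are `θ ↦ (a sin (2 M θ) / (2 M), - (a / M) cos θ)` with `M = 2 ^ n` and `a = λ ^ n`
(`oscillatingCurve`). Their length is comparable to `a`, their diameter to `a / M`. The straight
segment from the `n`-th to the `(n + 1)`-st stays in the three-parameter family `wiggle`. At the
zeros `0`, `π` of the second velocity component `sin θ` both harmonics of the first one equal `1`,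
so the speed is at least of order `a / M ^ 2` (`le_norm_deriv_wiggle`). Crude pointwise
bounds then give an energy at most a constant times `M ^ (-2) + a ^ (p - 1) * M ^ 14`
(`exists_sobolevMetric_wiggle_le`). As `p ≠ 1`, the factor `λ` can be chosen with
`λ ^ (p - 1) = 2 ^ (-16)`, greater than one if `p < 1` and less than one if `p > 1`. The energy is
then of order `4 ^ (-n)`, so the sequence is Cauchy.

There is no limit because `ℓ ^ ((p - 1) / 2)` is Lipschitz for the geodesic distance
(`lipschitzWith_curveLength_rpow`), while it tends to zero along the sequence. For the Lipschitz
bound, the derivative of the length in the direction `h` is at most `∫ |h'| dθ`; since `D_s h` has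
mean zero with respect to `ds`, a Poincaré inequality and Cauchy--Schwarz bound this by
`ℓ ^ (3 / 2) * √(∫ |D_s² h|² ds)` (`SobolevTwo.mul_sq_integral_norm_deriv_le`).

For the last two parts, `p = 0` and `p = 2` satisfy the respective integral conditions.
-/

noncomputable section

namespace SobolevCurves

variable {d : ℕ}

/-! ### Paths of immersions as paths in the Hilbert space -/

theorem mfderiv_path_apply_one {γ : ℝ → SobolevImmersion d} {t : ℝ}
    (h : MDifferentiableAt 𝓘(ℝ) 𝓘(ℝ, SobolevTwo d) γ t) :
    (mfderiv 𝓘(ℝ) 𝓘(ℝ, SobolevTwo d) γ t (1 : ℝ) : SobolevTwo d)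
      = deriv (fun t => (γ t : SobolevTwo d)) t := by
  simp only [mfderiv, h, writtenInExtChartAt]
  simp
  rfl

theorem contMDiffAt_path {γ : ℝ → SobolevImmersion d} {t : ℝ}
    (h : ContDiffAt ℝ 1 (fun t => (γ t : SobolevTwo d)) t) :
    ContMDiffAt 𝓘(ℝ) 𝓘(ℝ, SobolevTwo d) 1 γ t := by
  rw [contMDiffAt_iff]
  refine ⟨?_, ?_⟩
  · exact Topology.IsInducing.subtypeVal.continuousAt_iff.2 h.continuousAt
  · simp
    exact h.contDiffWithinAt

/-- Nearby immersions are joined by a `C¹` path in the ambient Hilbert space whose length, computed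
with the ordinary derivative, is as close to the geodesic distance as desired. -/
theorem exists_path_of_geodesicEDist_lt {a : Fin 3 → ℝ → ℝ} {c₀ c₁ : SobolevImmersion d}
    {r : ℝ≥0∞} (hr : geodesicEDist a c₀ c₁ < r) :
    ∃ Γ : ℝ → SobolevTwo d, ContDiff ℝ 1 Γ ∧ (∀ t θ, deriv (Γ t) θ ≠ 0) ∧ Γ 0 = c₀ ∧ Γ 1 = c₁ ∧
      ∫⁻ t in Icc (0 : ℝ) 1,
        ENNReal.ofReal (√(sobolevMetric a (Γ t) ⇑(deriv Γ t) ⇑(deriv Γ t))) < r := by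
  let := fun c : SobolevImmersion d => tangentENorm a c
  have := fun c : SobolevImmersion d => tangentENorm_smul a c
  obtain ⟨γ, h0, h1, hγ, hlen, -, -⟩ :=
    Manifold.exists_lt_locally_constant_of_riemannianEDist_lt hr zero_lt_one
  refine ⟨fun t => γ t, ?_, fun t => (γ t).2, congrArg Subtype.val h0,
    congrArg Subtype.val h1, ?_⟩
  · exact contMDiff_iff_contDiff.1 (contMDiff_subtype_val.comp hγ)
  · refine lt_of_eq_of_lt ?_ hlen
    rw [Manifold.pathELength_eq_lintegral_mfderiv_Icc]
    refine lintegral_congr fun t => ?_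
    let u : SobolevTwo d := mfderiv 𝓘(ℝ) 𝓘(ℝ, SobolevTwo d) γ t (1 : ℝ)
    change _ = ENNReal.ofReal (√(sobolevMetric a (γ t : SobolevTwo d) u u))
    have h : u = _ := mfderiv_path_apply_one (hγ.mdifferentiable one_ne_zero t)
    rw [h]

/-- If the straight segment between two immersions consists of immersions, its energy bounds the
geodesic distance. -/
theorem geodesicEDist_le_of_segment {a : Fin 3 → ℝ → ℝ} {c₀ c₁ : SobolevImmersion d} {B : ℝ}
    {h : SobolevTwo d} (hh : (c₁ : SobolevTwo d) = (c₀ : SobolevTwo d) + h)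
    (hU : ∀ t ∈ Icc (0 : ℝ) 1, (c₀ : SobolevTwo d) + t • h ∈ SobolevImmersion d)
    (hG : ∀ t ∈ Icc (0 : ℝ) 1, √(sobolevMetric a ⇑((c₀ : SobolevTwo d) + t • h) h h) ≤ B) :
    geodesicEDist a c₀ c₁ ≤ ENNReal.ofReal B := by
  classical
  let := fun c : SobolevImmersion d => tangentENorm a c
  have := fun c : SobolevImmersion d => tangentENorm_smul a c
  let ρ : ℝ → SobolevTwo d := fun t => (c₀ : SobolevTwo d) + t • h
  have hρ : ContDiff ℝ 1 ρ := contDiff_const.add (contDiff_id.smul contDiff_const)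
  have hρd : ∀ t, deriv ρ t = h := fun t => by
    have : HasDerivAt ρ ((1 : ℝ) • h) t := ((hasDerivAt_id t).smul_const h).const_add _
    rw [this.deriv, one_smul]
  -- Off the open set of immersions the path takes a dummy value.
  let γ : ℝ → SobolevImmersion d := fun t =>
    if ht : ρ t ∈ SobolevImmersion d then ⟨ρ t, ht⟩ else c₀
  have hγ : ∀ t ∈ Icc (0 : ℝ) 1, (fun t => (γ t : SobolevTwo d)) =ᶠ[𝓝 t] ρ := by
    intro t ht
    filter_upwards [hρ.continuous.continuousAt.preimage_mem_nhds
      ((SobolevImmersion d).isOpen.mem_nhds (hU t ht))] with s hs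
    have hs' : ρ s ∈ SobolevImmersion d := hs
    simp [γ, hs']
  have hγs : ∀ t ∈ Icc (0 : ℝ) 1, ContMDiffAt 𝓘(ℝ) 𝓘(ℝ, SobolevTwo d) 1 γ t := fun t ht =>
    contMDiffAt_path (hρ.contDiffAt.congr_of_eventuallyEq (hγ t ht))
  have e0 : γ 0 = c₀ := by
    refine Subtype.ext ((hγ 0 (by simp)).self_of_nhds.trans ?_)
    simp [ρ]
  have e1 : γ 1 = c₁ := by
    refine Subtype.ext ((hγ 1 (by simp)).self_of_nhds.trans ?_)
    simp [ρ, hh]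
  refine (Manifold.riemannianEDist_le_pathELength
    (fun t ht => (hγs t ht).contMDiffWithinAt) e0 e1 zero_le_one).trans ?_
  rw [Manifold.pathELength_eq_lintegral_mfderiv_Icc]
  refine (setLIntegral_mono' (g := fun _ => ENNReal.ofReal B) measurableSet_Icc
    fun t ht => ?_).trans (by simp)
  let u : SobolevTwo d := mfderiv 𝓘(ℝ) 𝓘(ℝ, SobolevTwo d) γ t (1 : ℝ)
  change ENNReal.ofReal (√(sobolevMetric a (γ t : SobolevTwo d) u u)) ≤ _
  have hd : u = _ := mfderiv_path_apply_one ((hγs t ht).mdifferentiableAt one_ne_zero)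
  have ht' : (γ t : SobolevTwo d) = ρ t := (hγ t ht).self_of_nhds
  rw [hd, (hγ t ht).deriv_eq, hρd, ht']
  exact ENNReal.ofReal_le_ofReal (hG t ht)

/-! ### The second arc length derivative -/

theorem hasDerivAt_arcDeriv {c h : ℝ → Euc d} {θ : ℝ} {u w : Euc d}
    (hc : HasDerivAt (deriv c) u θ) (hh : HasDerivAt (deriv h) w θ) (h0 : deriv c θ ≠ 0) :
    HasDerivAt (arcDeriv c h)
      (‖deriv c θ‖⁻¹ • w - (inner ℝ (deriv c θ) u / ‖deriv c θ‖ ^ 3) • deriv h θ) θ := by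
  have hn : ‖deriv c θ‖ ≠ 0 := norm_ne_zero_iff.2 h0
  have h1 : HasDerivAt (fun θ => ‖deriv c θ‖) (inner ℝ (deriv c θ) u / ‖deriv c θ‖) θ := by
    have h2 := hc.norm_sq.sqrt (pow_ne_zero 2 hn)
    simp only [Real.sqrt_sq (norm_nonneg _)] at h2
    convert h2 using 1
    field_simp
  have h3 := (h1.fun_inv hn).smul hh
  refine h3.congr_deriv ?_
  rw [sub_eq_add_neg, ← neg_smul]
  congr 2
  field_simp

theorem norm_arcDeriv_arcDeriv_le {c h : ℝ → Euc d} {θ m K' H H' : ℝ} {u w : Euc d}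
    (hc : HasDerivAt (deriv c) u θ) (hh : HasDerivAt (deriv h) w θ) (hm : 0 < m)
    (hcm : m ≤ ‖deriv c θ‖) (hu : ‖u‖ ≤ K') (hh1 : ‖deriv h θ‖ ≤ H) (hw : ‖w‖ ≤ H') :
    ‖arcDeriv c (arcDeriv c h) θ‖ ≤ H' / m ^ 2 + H * K' / m ^ 3 := by
  have hpos : 0 < ‖deriv c θ‖ := hm.trans_le hcm
  have hH : 0 ≤ H := (norm_nonneg _).trans hh1
  have hH' : 0 ≤ H' := (norm_nonneg _).trans hw
  have hK' : 0 ≤ K' := (norm_nonneg _).trans hu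
  rw [arcDeriv, (hasDerivAt_arcDeriv hc hh (norm_pos_iff.1 hpos)).deriv, norm_smul, norm_inv,
    norm_norm]
  have h1 : ‖‖deriv c θ‖⁻¹ • w - (inner ℝ (deriv c θ) u / ‖deriv c θ‖ ^ 3) • deriv h θ‖
      ≤ ‖deriv c θ‖⁻¹ * H' + K' / ‖deriv c θ‖ ^ 2 * H := by
    refine (norm_sub_le _ _).trans (add_le_add ?_ ?_)
    · rw [norm_smul, norm_inv, norm_norm]
      gcongr
    · rw [norm_smul, norm_div, norm_pow, norm_norm]
      have h2 : ‖inner ℝ (deriv c θ) u‖ ≤ ‖deriv c θ‖ * K' :=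
        (norm_inner_le_norm _ _).trans (by gcongr)
      calc _ ≤ (‖deriv c θ‖ * K') / ‖deriv c θ‖ ^ 3 * H := by gcongr
        _ = _ := by field_simp
  calc _ ≤ ‖deriv c θ‖⁻¹ * (‖deriv c θ‖⁻¹ * H' + K' / ‖deriv c θ‖ ^ 2 * H) := by gcongr
    _ = H' / ‖deriv c θ‖ ^ 2 + H * K' / ‖deriv c θ‖ ^ 3 := by field_simp
    _ ≤ _ := by gcongr

/-! ### Absolutely continuous vector-valued functions -/

theorem absolutelyContinuousOnInterval_of_dist_le {X Y : Type*} [PseudoMetricSpace X]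
    [PseudoMetricSpace Y] {f : ℝ → X} {G : ℝ → Y} {K a b : ℝ}
    (hG : AbsolutelyContinuousOnInterval G a b)
    (h : ∀ x ∈ uIcc a b, ∀ y ∈ uIcc a b, dist (f x) (f y) ≤ K * dist (G x) (G y)) :
    AbsolutelyContinuousOnInterval f a b := by
  unfold AbsolutelyContinuousOnInterval at hG ⊢
  refine squeeze_zero' (.of_forall fun _ => Finset.sum_nonneg fun _ _ => dist_nonneg) ?_
    (by simpa using hG.const_mul K)
  rw [eventually_inf_principal]
  filter_upwards with E hE
  rw [Finset.mul_sum]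
  exact Finset.sum_le_sum fun i hi => h _ (hE.1 i hi).1 _ (hE.1 i hi).2

theorem absolutelyContinuousOnInterval_integral {F : Type*} [NormedAddCommGroup F]
    [NormedSpace ℝ F] {g : ℝ → F} {a b : ℝ} (hg : IntervalIntegrable g volume a b) :
    AbsolutelyContinuousOnInterval (fun x => ∫ s in a..x, g s) a b := by
  refine absolutelyContinuousOnInterval_of_dist_le (K := 1)
    (hg.norm.absolutelyContinuousOnInterval_intervalIntegral left_mem_uIcc) fun x hx y hy => ?_
  have hsub : ∀ z ∈ uIcc a b, IntervalIntegrable g volume a z := fun z hz =>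
    hg.mono_set (uIcc_subset_uIcc left_mem_uIcc hz)
  rw [one_mul, dist_eq_norm, dist_eq_norm,
    intervalIntegral.integral_interval_sub_left (hsub x hx) (hsub y hy),
    intervalIntegral.integral_interval_sub_left (hsub x hx).norm (hsub y hy).norm]
  exact intervalIntegral.norm_integral_le_abs_integral_norm

/-- The fundamental theorem of calculus for absolutely continuous vector-valued functions. -/
theorem integral_eq_sub_of_absolutelyContinuousOnInterval {F : Type*} [NormedAddCommGroup F]
    [NormedSpace ℝ F] [CompleteSpace F] {f f' : ℝ → F} {a b : ℝ}
    (hf : AbsolutelyContinuousOnInterval f a b)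
    (hf' : ∀ᵐ x : ℝ, x ∈ uIcc a b → HasDerivAt f (f' x) x)
    (hi : IntervalIntegrable f' volume a b) : ∫ s in a..b, f' s = f b - f a := by
  have hac := hf.fun_sub (absolutelyContinuousOnInterval_integral hi)
  obtain ⟨C, hC⟩ := hac.const_of_ae_hasDerivAt_zero (by
    filter_upwards [hf', hi.ae_hasDerivAt_integral] with x h1 h2 hx
    simpa using (h1 hx).fun_sub (h2 hx a left_mem_uIcc))
  have h1 := hC a left_mem_uIcc
  have h2 := hC b right_mem_uIcc
  simp only [intervalIntegral.integral_same, sub_zero] at h1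
  rw [← h1] at h2
  rw [← h2]
  abel

/-! ### A Poincaré inequality along a closed curve -/

namespace SobolevTwo

theorem zero_mem_period : (0 : ℝ) ∈ Icc 0 (2 * Real.pi) := ⟨le_rfl, two_pi_nonneg⟩

theorem two_pi_mem_period : (2 * Real.pi) ∈ Icc 0 (2 * Real.pi) := ⟨two_pi_nonneg, le_rfl⟩

theorem continuous_deriv (f : SobolevTwo d) : Continuous (deriv f) :=
  f.isSobolevTwo.contDiff.continuous_deriv le_rfl

theorem absolutelyContinuousOnInterval_deriv (f : SobolevTwo d) :
    AbsolutelyContinuousOnInterval (deriv f) 0 (2 * Real.pi) := by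
  obtain ⟨g, hg, e⟩ := f.isSobolevTwo.primitive
  refine absolutelyContinuousOnInterval_of_dist_le (K := 1)
    (absolutelyContinuousOnInterval_integral
      (MemLp.intervalIntegrable_of_mem hg zero_mem_period two_pi_mem_period)) fun x hx y hy => ?_
  rw [uIcc_of_le two_pi_nonneg] at hx hy
  rw [e x hx, e y hy, one_mul, dist_add_left]

theorem exists_pos_le_norm_deriv {c : SobolevTwo d} (hc : ∀ θ, deriv c θ ≠ 0) :
    ∃ m > 0, ∀ θ, m ≤ ‖deriv c θ‖ := by
  obtain ⟨t₀, -, ht₀⟩ := isCompact_Icc.exists_isMinOn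
    (nonempty_Icc.2 two_pi_nonneg) c.continuous_deriv.norm.continuousOn
  refine ⟨‖deriv c t₀‖, norm_pos_iff.2 (hc t₀), fun θ => ?_⟩
  obtain ⟨s, hs, hst⟩ := c.deriv_periodic.exists_mem_Ico₀ Real.two_pi_pos θ
  rw [hst]
  exact ht₀ (Ico_subset_Icc_self hs)

theorem continuous_arcDeriv {c : SobolevTwo d} (hc : ∀ θ, deriv c θ ≠ 0) (h : SobolevTwo d) :
    Continuous (arcDeriv c h) :=
  (c.continuous_deriv.norm.inv₀ fun θ => norm_ne_zero_iff.2 (hc θ)).smul h.continuous_deriv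

theorem absolutelyContinuousOnInterval_arcDeriv {c : SobolevTwo d} (hc : ∀ θ, deriv c θ ≠ 0)
    (h : SobolevTwo d) : AbsolutelyContinuousOnInterval (arcDeriv c h) 0 (2 * Real.pi) := by
  obtain ⟨m, hm, hmc⟩ := exists_pos_le_norm_deriv hc
  have h1 : AbsolutelyContinuousOnInterval (fun θ => ‖deriv c θ‖⁻¹) 0 (2 * Real.pi) := by
    refine absolutelyContinuousOnInterval_of_dist_le (K := (m ^ 2)⁻¹)
      c.absolutelyContinuousOnInterval_deriv fun x _ y _ => ?_
    have hx := hm.trans_le (hmc x)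
    have hy := hm.trans_le (hmc y)
    rw [Real.dist_eq, inv_sub_inv hx.ne' hy.ne', abs_div, abs_of_pos (mul_pos hx hy),
      div_eq_inv_mul, dist_comm, dist_eq_norm, sq]
    have := hmc x
    have := hmc y
    gcongr
    exact abs_norm_sub_norm_le _ _
  exact h1.fun_smul h.absolutelyContinuousOnInterval_deriv

theorem ae_hasDerivAt_arcDeriv {c : SobolevTwo d} (hc : ∀ θ, deriv c θ ≠ 0)
    (h : SobolevTwo d) : ∀ᵐ θ ∂(volume.restrict (Ioc 0 (2 * Real.pi))),
      HasDerivAt (arcDeriv c h) (deriv (arcDeriv c h) θ) θ := by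
  filter_upwards [c.ae_differentiableAt, h.ae_differentiableAt] with θ h1 h2
  exact (hasDerivAt_arcDeriv h1.hasDerivAt h2.hasDerivAt (hc θ)).differentiableAt.hasDerivAt

theorem memLp_deriv_arcDeriv {c : SobolevTwo d} (hc : ∀ θ, deriv c θ ≠ 0)
    (h : SobolevTwo d) :
    MemLp (deriv (arcDeriv c h)) 2 (volume.restrict (Ioc 0 (2 * Real.pi))) := by
  obtain ⟨m, hm, hmc⟩ := exists_pos_le_norm_deriv hc
  set H := √(2 * Real.pi) * ‖h‖ with hH
  have hH0 : 0 ≤ H := by positivity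
  have hbound : MemLp (fun θ => m⁻¹ * ‖deriv (deriv h) θ‖ + (m ^ 2)⁻¹ * H * ‖deriv (deriv c) θ‖) 2
      (volume.restrict (Ioc 0 (2 * Real.pi))) :=
    (h.memLp_deriv_deriv.norm.const_mul _).add (c.memLp_deriv_deriv.norm.const_mul _)
  refine hbound.mono (stronglyMeasurable_deriv _).aestronglyMeasurable ?_
  filter_upwards [c.ae_differentiableAt, h.ae_differentiableAt] with θ h1 h2
  have hθ := hmc θ
  have hpos := hm.trans_le hθ
  rw [(hasDerivAt_arcDeriv h1.hasDerivAt h2.hasDerivAt (hc θ)).deriv]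
  refine le_trans ?_ (le_abs_self _)
  refine (norm_sub_le _ _).trans (add_le_add ?_ ?_)
  · rw [norm_smul, norm_inv, norm_norm]
    gcongr
  · rw [norm_smul, norm_div, norm_pow, norm_norm]
    have h3 := norm_inner_le_norm (𝕜 := ℝ) (deriv c θ) (deriv (deriv c) θ)
    have h4 := h.norm_deriv_le θ
    calc _ ≤ ‖deriv c θ‖ * ‖deriv (deriv c) θ‖ / ‖deriv c θ‖ ^ 3 * H := by gcongr
      _ = (‖deriv c θ‖ ^ 2)⁻¹ * H * ‖deriv (deriv c) θ‖ := by field_simp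
      _ ≤ _ := by gcongr

theorem norm_arcDeriv_sub_le {c : SobolevTwo d} (hc : ∀ θ, deriv c θ ≠ 0) (h : SobolevTwo d)
    {x y : ℝ} (hx : x ∈ Icc 0 (2 * Real.pi)) (hy : y ∈ Icc 0 (2 * Real.pi)) :
    ‖arcDeriv c h x - arcDeriv c h y‖
      ≤ ∫ θ in (0 : ℝ)..(2 * Real.pi), ‖deriv (arcDeriv c h) θ‖ := by
  have hL := memLp_deriv_arcDeriv hc h
  have hn := (MemLp.intervalIntegrable_of_mem hL zero_mem_period two_pi_mem_period).norm
  have hsub : uIcc y x ⊆ uIcc 0 (2 * Real.pi) := by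
    rw [uIcc_of_le two_pi_nonneg]
    exact uIcc_subset_Icc hy hx
  have hd : ∀ᵐ θ : ℝ, θ ∈ uIcc y x → HasDerivAt (arcDeriv c h) (deriv (arcDeriv c h) θ) θ := by
    have hne : ∀ᵐ t : ℝ, t ≠ 0 := by simp [ae_iff]
    filter_upwards [(ae_restrict_iff' measurableSet_Ioc).1 (ae_hasDerivAt_arcDeriv hc h), hne]
      with θ h1 h2 h3
    have h4 := hsub h3
    rw [uIcc_of_le two_pi_nonneg] at h4
    exact h1 ⟨lt_of_le_of_ne h4.1 h2.symm, h4.2⟩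
  rw [← integral_eq_sub_of_absolutelyContinuousOnInterval
    ((absolutelyContinuousOnInterval_arcDeriv hc h).mono hsub) hd
    (MemLp.intervalIntegrable_of_mem hL hy hx)]
  refine intervalIntegral.norm_integral_le_abs_integral_norm.trans ?_
  rw [← abs_of_nonneg (intervalIntegral.integral_nonneg two_pi_nonneg
    (fun s _ => norm_nonneg (deriv (arcDeriv c h) s)))]
  refine intervalIntegral.abs_integral_mono_interval ?_ ?_ hn
  · rw [uIoc_of_le two_pi_nonneg]
    intro z hz
    rw [uIoc, mem_Ioc] at hz
    exact ⟨lt_of_le_of_lt (le_min hy.1 hx.1) hz.1, hz.2.trans (max_le hy.2 hx.2)⟩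
  · filter_upwards with s using norm_nonneg _

theorem curveLength_pos {c : SobolevTwo d} (hc : ∀ θ, deriv c θ ≠ 0) : 0 < curveLength c :=
  intervalIntegral.intervalIntegral_pos_of_pos
    (c.continuous_deriv.norm.intervalIntegrable _ _) (fun θ => norm_pos_iff.2 (hc θ))
    Real.two_pi_pos

theorem integral_deriv_eq_zero (h : SobolevTwo d) :
    ∫ θ in (0 : ℝ)..(2 * Real.pi), deriv h θ = 0 := by
  rw [intervalIntegral.integral_deriv_eq_sub
    (fun x _ => h.isSobolevTwo.contDiff.differentiable one_ne_zero x)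
    (h.continuous_deriv.intervalIntegrable _ _)]
  have := h.isSobolevTwo.periodic 0
  rw [zero_add] at this
  rw [this, sub_self]

/-- The arc length derivative has mean zero with respect to arc length, so it is bounded by its
total variation. -/
theorem norm_arcDeriv_le {c : SobolevTwo d} (hc : ∀ θ, deriv c θ ≠ 0) (h : SobolevTwo d)
    {x : ℝ} (hx : x ∈ Icc 0 (2 * Real.pi)) :
    ‖arcDeriv c h x‖ ≤ ∫ θ in (0 : ℝ)..(2 * Real.pi), ‖deriv (arcDeriv c h) θ‖ := by
  set A := ∫ θ in (0 : ℝ)..(2 * Real.pi), ‖deriv (arcDeriv c h) θ‖ with hA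
  have hcn := c.continuous_deriv.norm
  have hl := curveLength_pos hc
  have hsmul : ∀ θ, ‖deriv c θ‖ • arcDeriv c h θ = deriv h θ := fun θ => by
    rw [arcDeriv, smul_inv_smul₀ (norm_ne_zero_iff.2 (hc θ))]
  have h1 : ∫ θ in (0 : ℝ)..(2 * Real.pi), ‖deriv c θ‖ • (arcDeriv c h x - arcDeriv c h θ)
      = curveLength c • arcDeriv c h x := by
    simp only [smul_sub, hsmul]
    have hsm : Continuous fun θ => ‖deriv c θ‖ • arcDeriv c h x := hcn.smul continuous_const
    rw [intervalIntegral.integral_sub (hsm.intervalIntegrable _ _)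
      (h.continuous_deriv.intervalIntegrable _ _), integral_deriv_eq_zero, sub_zero,
      intervalIntegral.integral_smul_const, curveLength]
  have h2 : ‖∫ θ in (0 : ℝ)..(2 * Real.pi), ‖deriv c θ‖ • (arcDeriv c h x - arcDeriv c h θ)‖
      ≤ ∫ θ in (0 : ℝ)..(2 * Real.pi), ‖deriv c θ‖ * A := by
    refine intervalIntegral.norm_integral_le_of_norm_le two_pi_nonneg ?_
      ((hcn.mul continuous_const).intervalIntegrable _ _)
    filter_upwards with θ hθ
    rw [norm_smul, norm_norm]
    gcongr
    exact norm_arcDeriv_sub_le hc h hx (Ioc_subset_Icc_self hθ)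
  rw [h1, norm_smul, intervalIntegral.integral_mul_const, Real.norm_eq_abs, abs_of_pos hl] at h2
  exact le_of_mul_le_mul_left h2 hl

theorem norm_arcDeriv_arcDeriv_mul_norm {c : SobolevTwo d} (hc : ∀ θ, deriv c θ ≠ 0) (h : ℝ → Euc d)
    (θ : ℝ) : ‖arcDeriv c (arcDeriv c h) θ‖ * ‖deriv c θ‖ = ‖deriv (arcDeriv c h) θ‖ := by
  have : ‖deriv c θ‖ ≠ 0 := norm_ne_zero_iff.2 (hc θ)
  rw [arcDeriv, norm_smul, norm_inv, norm_norm]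
  field_simp

theorem memLp_arcDeriv_arcDeriv {c : SobolevTwo d} (hc : ∀ θ, deriv c θ ≠ 0)
    (h : SobolevTwo d) :
    MemLp (arcDeriv c (arcDeriv c h)) 2 (volume.restrict (Ioc 0 (2 * Real.pi))) := by
  obtain ⟨m, hm, hmc⟩ := exists_pos_le_norm_deriv hc
  refine (memLp_deriv_arcDeriv hc h).of_le_mul (c := m⁻¹) ?_ ?_
  · exact (c.continuous_deriv.norm.inv₀ fun θ =>
      norm_ne_zero_iff.2 (hc θ)).aestronglyMeasurable.smul
      (stronglyMeasurable_deriv _).aestronglyMeasurable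
  · filter_upwards with θ
    rw [arcDeriv, norm_smul, norm_inv, norm_norm]
    have := hmc θ
    gcongr

theorem intervalIntegrable_arcDeriv_arcDeriv_sq {c : SobolevTwo d} (hc : ∀ θ, deriv c θ ≠ 0)
    (h : SobolevTwo d) : IntervalIntegrable
      (fun θ => ‖arcDeriv c (arcDeriv c h) θ‖ ^ 2 * ‖deriv c θ‖) volume 0 (2 * Real.pi) := by
  refine IntervalIntegrable.mul_continuousOn ?_ c.continuous_deriv.norm.continuousOn
  rw [intervalIntegrable_iff_integrableOn_Ioc_of_le two_pi_nonneg]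
  exact (memLp_arcDeriv_arcDeriv hc h).integrable_norm_pow (by norm_num)

theorem sq_integral_norm_deriv_arcDeriv_le {c : SobolevTwo d} (hc : ∀ θ, deriv c θ ≠ 0)
    (h : SobolevTwo d) :
    (∫ θ in (0 : ℝ)..(2 * Real.pi), ‖deriv (arcDeriv c h) θ‖) ^ 2 ≤ curveLength c *
      ∫ θ in (0 : ℝ)..(2 * Real.pi), ‖arcDeriv c (arcDeriv c h) θ‖ ^ 2 * ‖deriv c θ‖ := by
  set A := ∫ θ in (0 : ℝ)..(2 * Real.pi), ‖deriv (arcDeriv c h) θ‖ with hA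
  set V := ∫ θ in (0 : ℝ)..(2 * Real.pi), ‖arcDeriv c (arcDeriv c h) θ‖ ^ 2 * ‖deriv c θ‖ with hV
  have hl := curveLength_pos hc
  set s := A / curveLength c with hs
  have hi1 := intervalIntegrable_arcDeriv_arcDeriv_sq hc h
  have hi2 := (MemLp.intervalIntegrable_of_mem (memLp_deriv_arcDeriv hc h) zero_mem_period
    two_pi_mem_period).norm
  have hi3 := c.continuous_deriv.norm.intervalIntegrable (μ := volume) 0 (2 * Real.pi)
  -- Cauchy--Schwarz: expand `∫ (|D_s² h| - s)² ds ≥ 0` at the optimal `s`.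
  have h1 : 0 ≤ ∫ θ in (0 : ℝ)..(2 * Real.pi),
      (‖arcDeriv c (arcDeriv c h) θ‖ ^ 2 * ‖deriv c θ‖ - 2 * s * ‖deriv (arcDeriv c h) θ‖
        + s ^ 2 * ‖deriv c θ‖) := by
    refine intervalIntegral.integral_nonneg two_pi_nonneg fun θ _ => ?_
    rw [← norm_arcDeriv_arcDeriv_mul_norm hc h θ]
    have : 0 ≤ (‖arcDeriv c (arcDeriv c h) θ‖ - s) ^ 2 * ‖deriv c θ‖ := by positivity
    linarith
  rw [intervalIntegral.integral_add (hi1.sub (hi2.const_mul _)) (hi3.const_mul _),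
    intervalIntegral.integral_sub hi1 (hi2.const_mul _), intervalIntegral.integral_const_mul,
    intervalIntegral.integral_const_mul, ← hA, ← hV] at h1
  change 0 ≤ V - 2 * s * A + s ^ 2 * curveLength c at h1
  have h2 : V - 2 * s * A + s ^ 2 * curveLength c = V - A ^ 2 / curveLength c := by
    rw [hs]
    field_simp
    ring
  rw [h2, sub_nonneg, div_le_iff₀ hl] at h1
  linarith

theorem mul_integral_arcDeriv_arcDeriv_sq_le {a : Fin 3 → ℝ → ℝ} {c : SobolevTwo d}
    (ha : ∀ j, 0 ≤ a j (curveLength c)) (hc : ∀ θ, deriv c θ ≠ 0) (h : SobolevTwo d) :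
    a 2 (curveLength c) *
      ∫ θ in (0 : ℝ)..(2 * Real.pi), ‖arcDeriv c (arcDeriv c h) θ‖ ^ 2 * ‖deriv c θ‖
      ≤ sobolevMetric a c h h := by
  have hi := intervalIntegrable_arcDeriv_arcDeriv_sq hc h
  have hc' := c.continuous_deriv.norm
  have hh : Continuous h := h.isSobolevTwo.contDiff.continuous
  have h0 : IntervalIntegrable (fun θ => (a 0 (curveLength c) * ‖h θ‖ ^ 2
      + a 1 (curveLength c) * ‖arcDeriv c h θ‖ ^ 2) * ‖deriv c θ‖) volume 0 (2 * Real.pi) :=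
    ((((hh.norm.pow 2).const_mul _).add
      (((continuous_arcDeriv hc h).norm.pow 2).const_mul _)).mul hc').intervalIntegrable _ _
  have he : sobolevMetric a c h h = ∫ θ in (0 : ℝ)..(2 * Real.pi),
      ((a 0 (curveLength c) * ‖h θ‖ ^ 2
      + a 1 (curveLength c) * ‖arcDeriv c h θ‖ ^ 2) * ‖deriv c θ‖
      + a 2 (curveLength c) * (‖arcDeriv c (arcDeriv c h) θ‖ ^ 2 * ‖deriv c θ‖)) := by
    unfold sobolevMetric
    congr 1
    funext θ
    rw [Fin.sum_univ_three]
    simp only [real_inner_self_eq_norm_sq, Fin.val_zero, Fin.val_one, Fin.val_two,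
      Function.iterate_succ_apply', Function.iterate_zero, id]
    ring
  rw [he, intervalIntegral.integral_add h0 (hi.const_mul _), intervalIntegral.integral_const_mul]
  refine le_add_of_nonneg_left (intervalIntegral.integral_nonneg two_pi_nonneg fun θ _ => ?_)
  have := ha 0
  have := ha 1
  positivity

/-- The variation of length is controlled by the second order term of the metric. -/
theorem mul_sq_integral_norm_deriv_le {a : Fin 3 → ℝ → ℝ} {c : SobolevTwo d}
    (ha : ∀ j, 0 ≤ a j (curveLength c)) (hc : ∀ θ, deriv c θ ≠ 0) (h : SobolevTwo d) :
    a 2 (curveLength c) * (∫ θ in (0 : ℝ)..(2 * Real.pi), ‖deriv h θ‖) ^ 2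
      ≤ curveLength c ^ 3 * sobolevMetric a c h h := by
  set A := ∫ θ in (0 : ℝ)..(2 * Real.pi), ‖deriv (arcDeriv c h) θ‖ with hA
  set V := ∫ θ in (0 : ℝ)..(2 * Real.pi), ‖arcDeriv c (arcDeriv c h) θ‖ ^ 2 * ‖deriv c θ‖ with hV
  have hl := curveLength_pos hc
  have h1 : ∫ θ in (0 : ℝ)..(2 * Real.pi), ‖deriv h θ‖ ≤ curveLength c * A := by
    rw [curveLength, ← intervalIntegral.integral_mul_const]
    refine intervalIntegral.integral_mono_on two_pi_nonneg
      (h.continuous_deriv.norm.intervalIntegrable _ _)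
      ((c.continuous_deriv.norm.mul continuous_const).intervalIntegrable _ _) fun θ hθ => ?_
    have h2 := norm_arcDeriv_le hc h hθ
    have h3 : deriv h θ = ‖deriv c θ‖ • arcDeriv c h θ := by
      rw [arcDeriv, smul_inv_smul₀ (norm_ne_zero_iff.2 (hc θ))]
    rw [h3, norm_smul, norm_norm]
    gcongr
  have h0 : 0 ≤ ∫ θ in (0 : ℝ)..(2 * Real.pi), ‖deriv h θ‖ :=
    intervalIntegral.integral_nonneg two_pi_nonneg fun θ _ => norm_nonneg _
  have h2 := ha 2
  calc _ ≤ a 2 (curveLength c) * (curveLength c * A) ^ 2 := by gcongr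
    _ = a 2 (curveLength c) * (curveLength c ^ 2 * A ^ 2) := by ring
    _ ≤ a 2 (curveLength c) * (curveLength c ^ 2 * (curveLength c * V)) := by
      gcongr
      exact sq_integral_norm_deriv_arcDeriv_le hc h
    _ = curveLength c ^ 3 * (a 2 (curveLength c) * V) := by ring
    _ ≤ _ := by
      gcongr
      exact mul_integral_arcDeriv_arcDeriv_sq_le ha hc h

end SobolevTwo

/-! ### Length along a path of immersions -/

namespace SobolevTwo

theorem deriv_add_apply (f g : SobolevTwo d) (θ : ℝ) :
    deriv (f + g : SobolevTwo d) θ = deriv f θ + deriv g θ :=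
  deriv_add (f.isSobolevTwo.contDiff.differentiable one_ne_zero θ)
    (g.isSobolevTwo.contDiff.differentiable one_ne_zero θ)

theorem deriv_smul_apply (r : ℝ) (f : SobolevTwo d) (θ : ℝ) :
    deriv (r • f : SobolevTwo d) θ = r • deriv f θ :=
  deriv_const_smul_field r _

/-- Evaluation of the derivative at a point, as a continuous linear map. -/
def derivCLM (θ : ℝ) : SobolevTwo d →L[ℝ] Euc d :=
  LinearMap.mkContinuous
    { toFun := fun f => deriv f θ
      map_add' := fun f g => deriv_add_apply f g θ
      map_smul' := fun r f => deriv_smul_apply r f θ } (√(2 * Real.pi))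
    fun f => f.norm_deriv_le θ

theorem continuous_uncurry_deriv :
    Continuous fun x : SobolevTwo d × ℝ => deriv x.1 x.2 := by
  refine continuous_iff_continuousAt.2 fun ⟨f, θ⟩ => ?_
  rw [ContinuousAt, tendsto_iff_norm_sub_tendsto_zero]
  have h1 : Tendsto (fun x : SobolevTwo d × ℝ => √(2 * Real.pi) * ‖x.1 - f‖
      + ‖deriv f x.2 - deriv f θ‖) (𝓝 (f, θ)) (𝓝 0) := by
    have : Continuous fun x : SobolevTwo d × ℝ => √(2 * Real.pi) * ‖x.1 - f‖
        + ‖deriv f x.2 - deriv f θ‖ :=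
      (continuous_const.mul (continuous_fst.sub continuous_const).norm).add
        ((f.continuous_deriv.comp continuous_snd).sub continuous_const).norm
    simpa using this.tendsto (f, θ)
  refine squeeze_zero (fun _ => norm_nonneg _) (fun x => ?_) h1
  have h2 := norm_deriv_le (x.1 - f) x.2
  have h3 : deriv ((x.1 - f : SobolevTwo d) : ℝ → Euc d) x.2 = deriv x.1 x.2 - deriv f x.2 :=
    (derivCLM x.2).map_sub x.1 f
  rw [h3] at h2
  calc _ = ‖(deriv x.1 x.2 - deriv f x.2) + (deriv f x.2 - deriv f θ)‖ := by
        rw [sub_add_sub_cancel]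
    _ ≤ _ := (norm_add_le _ _).trans (by gcongr)

end SobolevTwo

theorem hasDerivAt_norm_deriv_path {Γ : ℝ → SobolevTwo d} {Γ' : SobolevTwo d} {t θ : ℝ}
    (hΓ : HasDerivAt Γ Γ' t) (h0 : deriv (Γ t) θ ≠ 0) :
    HasDerivAt (fun s => ‖deriv (Γ s) θ‖)
      (inner ℝ (deriv (Γ t) θ) (deriv Γ' θ) / ‖deriv (Γ t) θ‖) t := by
  have hn : ‖deriv (Γ t) θ‖ ≠ 0 := norm_ne_zero_iff.2 h0
  have h1 : HasDerivAt (fun s => deriv (Γ s) θ) (deriv Γ' θ) t :=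
    (SobolevTwo.derivCLM θ).hasFDerivAt.comp_hasDerivAt t hΓ
  have h2 := h1.norm_sq.sqrt (pow_ne_zero 2 hn)
  simp only [Real.sqrt_sq (norm_nonneg _)] at h2
  convert h2 using 1
  field_simp

theorem abs_inner_div_norm_le (u v : Euc d) : ‖inner ℝ u v / ‖u‖‖ ≤ ‖v‖ := by
  rw [norm_div, norm_norm]
  refine div_le_of_le_mul₀ (norm_nonneg _) (norm_nonneg _) ?_
  rw [mul_comm]
  exact norm_inner_le_norm u v

theorem hasDerivAt_curveLength_path {Γ : ℝ → SobolevTwo d} (hΓ : ContDiff ℝ 1 Γ)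
    (h0 : ∀ t θ, deriv (Γ t) θ ≠ 0) (t : ℝ) :
    HasDerivAt (fun t => curveLength (Γ t)) (∫ θ in (0 : ℝ)..(2 * Real.pi),
      inner ℝ (deriv (Γ t) θ) (deriv ⇑(deriv Γ t) θ) / ‖deriv (Γ t) θ‖) t := by
  have hd : Continuous (deriv Γ) := hΓ.continuous_deriv le_rfl
  have hs : {s | ‖deriv Γ s‖ < ‖deriv Γ t‖ + 1} ∈ 𝓝 t :=
    hd.norm.continuousAt.eventually_lt continuousAt_const (lt_add_one _)
  refine (intervalIntegral.hasDerivAt_integral_of_dominated_loc_of_deriv_le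
    (bound := fun _ => √(2 * Real.pi) * (‖deriv Γ t‖ + 1))
    (F' := fun t θ => inner ℝ (deriv (Γ t) θ) (deriv ⇑(deriv Γ t) θ) / ‖deriv (Γ t) θ‖)
    hs ?_ ?_ ?_ ?_ ?_ ?_).2
  · exact .of_forall fun s => (Γ s).continuous_deriv.norm.aestronglyMeasurable
  · exact (Γ t).continuous_deriv.norm.intervalIntegrable _ _
  · exact (((Γ t).continuous_deriv.inner (deriv Γ t).continuous_deriv).div
      (Γ t).continuous_deriv.norm fun θ => norm_ne_zero_iff.2 (h0 t θ)).aestronglyMeasurable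
  · refine .of_forall fun θ _ s hs => (abs_inner_div_norm_le _ _).trans ?_
    refine ((deriv Γ s).norm_deriv_le θ).trans ?_
    have hs' : ‖deriv Γ s‖ < ‖deriv Γ t‖ + 1 := hs
    gcongr
  · exact intervalIntegrable_const
  · exact .of_forall fun θ _ s _ => hasDerivAt_norm_deriv_path
      (hΓ.differentiable one_ne_zero s).hasDerivAt (h0 s θ)

theorem contDiff_curveLength_path {Γ : ℝ → SobolevTwo d} (hΓ : ContDiff ℝ 1 Γ)
    (h0 : ∀ t θ, deriv (Γ t) θ ≠ 0) : ContDiff ℝ 1 fun t => curveLength (Γ t) := by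
  have h1 := hasDerivAt_curveLength_path hΓ h0
  refine contDiff_one_iff_deriv.2 ⟨fun t => (h1 t).differentiableAt, ?_⟩
  rw [funext fun t => (h1 t).deriv]
  have hc : Continuous fun x : ℝ × ℝ => deriv (Γ x.1) x.2 :=
    SobolevTwo.continuous_uncurry_deriv.comp
      ((hΓ.continuous.comp continuous_fst).prodMk continuous_snd)
  have hd : Continuous fun x : ℝ × ℝ => deriv ⇑(deriv Γ x.1) x.2 :=
    SobolevTwo.continuous_uncurry_deriv.comp
      (((hΓ.continuous_deriv le_rfl).comp continuous_fst).prodMk continuous_snd)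
  refine intervalIntegral.continuous_parametric_intervalIntegral_of_continuous' ?_ _ _
  exact (hc.inner hd).div hc.norm fun x => norm_ne_zero_iff.2 (h0 x.1 x.2)

theorem powerWeight_nonneg (q p : ℝ) (j : Fin 3) {r : ℝ} (hr : 0 < r) :
    0 ≤ powerWeight q p j r := by
  fin_cases j <;> simp [powerWeight] <;> positivity

/-- The second order term of weight `ℓ ^ p` controls the speed of `ℓ ^ ((p - 1) / 2)`: the powers of
`ℓ` from the weight and from the Poincaré inequality cancel. -/
theorem norm_deriv_curveLength_rpow_le (q p : ℝ) {Γ : ℝ → SobolevTwo d} (hΓ : ContDiff ℝ 1 Γ)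
    (h0 : ∀ t θ, deriv (Γ t) θ ≠ 0) (t : ℝ) :
    ‖deriv (fun t => curveLength (Γ t) ^ ((p - 1) / 2)) t‖ ≤
      ‖(p - 1) / 2‖ * √(sobolevMetric (powerWeight q p) (Γ t) ⇑(deriv Γ t) ⇑(deriv Γ t)) := by
  set ℓ := curveLength (Γ t) with hℓ
  have hl : 0 < ℓ := SobolevTwo.curveLength_pos (h0 t)
  have h1 := hasDerivAt_curveLength_path hΓ h0 t
  rw [(h1.rpow_const (p := (p - 1) / 2) (Or.inl hl.ne')).deriv]
  set A := ∫ θ in (0 : ℝ)..(2 * Real.pi), ‖deriv ⇑(deriv Γ t) θ‖ with hA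
  have hA0 : 0 ≤ A := intervalIntegral.integral_nonneg two_pi_nonneg fun θ _ => norm_nonneg _
  have h2 : ‖∫ θ in (0 : ℝ)..(2 * Real.pi),
      inner ℝ (deriv (Γ t) θ) (deriv ⇑(deriv Γ t) θ) / ‖deriv (Γ t) θ‖‖ ≤ A := by
    refine intervalIntegral.norm_integral_le_of_norm_le two_pi_nonneg ?_
      ((deriv Γ t).continuous_deriv.norm.intervalIntegrable _ _)
    exact .of_forall fun θ _ => abs_inner_div_norm_le _ _
  have h3 := SobolevTwo.mul_sq_integral_norm_deriv_le
    (a := powerWeight q p) (fun j => powerWeight_nonneg q p j hl) (h0 t) (deriv Γ t)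
  set G := sobolevMetric (powerWeight q p) (Γ t) ⇑(deriv Γ t) ⇑(deriv Γ t)
  change ℓ ^ p * A ^ 2 ≤ ℓ ^ 3 * G at h3
  have h4 : ℓ ^ ((p - 1) / 2 - 1) * A ≤ √G := by
    refine Real.le_sqrt_of_sq_le ?_
    have h5 : (ℓ ^ ((p - 1) / 2 - 1)) ^ 2 = ℓ ^ p / ℓ ^ 3 := by
      rw [← Real.rpow_natCast (ℓ ^ ((p - 1) / 2 - 1)), ← Real.rpow_mul hl.le,
        ← Real.rpow_natCast ℓ 3, ← Real.rpow_sub hl]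
      congr 1
      push_cast
      ring
    rw [mul_pow, h5, div_mul_eq_mul_div, div_le_iff₀ (by positivity)]
    linarith
  have h6 : 0 < ℓ ^ ((p - 1) / 2 - 1) := Real.rpow_pos_of_pos hl _
  rw [norm_mul, norm_mul, Real.norm_of_nonneg h6.le]
  calc _ ≤ A * ‖(p - 1) / 2‖ * ℓ ^ ((p - 1) / 2 - 1) := by gcongr
    _ = ‖(p - 1) / 2‖ * (ℓ ^ ((p - 1) / 2 - 1) * A) := by ring
    _ ≤ _ := by gcongr

/-- The power `(p - 1) / 2` of the length is Lipschitz for the geodesic distance. -/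
theorem lipschitzWith_curveLength_rpow (q : ℝ) {p : ℝ} (hp : p ≠ 1) :
    LipschitzWith ‖(p - 1) / 2‖₊
      (fun c : GeodesicSpace d (powerWeight q p) => curveLength c.curve ^ ((p - 1) / 2)) := by
  intro c₁ c₀
  have hK : ‖(p - 1) / 2‖₊ ≠ 0 := by
    rw [Ne, nnnorm_eq_zero, div_eq_zero_iff, sub_eq_zero]
    simp [hp]
  have hK' : (‖(p - 1) / 2‖₊ : ℝ≥0∞) ≠ 0 := ENNReal.coe_ne_zero.2 hK
  rw [edist_comm c₁ c₀, edist_eq_enorm_sub, mul_comm, ← ENNReal.div_le_iff hK' ENNReal.coe_ne_top]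
  refine le_of_forall_gt_imp_ge_of_dense fun r hr => ?_
  obtain ⟨Γ, hΓ, h0, e0, e1, hlen⟩ := exists_path_of_geodesicEDist_lt hr
  rw [ENNReal.div_le_iff hK' ENNReal.coe_ne_top]
  have hF : ContDiff ℝ 1 fun t => curveLength (Γ t) ^ ((p - 1) / 2) :=
    (contDiff_curveLength_path hΓ h0).rpow_const_of_ne
      fun t => (SobolevTwo.curveLength_pos (h0 t)).ne'
  have h1 := enorm_sub_le_lintegral_deriv_of_contDiffOn_Icc hF.contDiffOn zero_le_one
  simp only [e0, e1] at h1
  refine h1.trans ?_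
  calc _ ≤ ∫⁻ t in Icc (0 : ℝ) 1, (‖(p - 1) / 2‖₊ : ℝ≥0∞) * ENNReal.ofReal
        (√(sobolevMetric (powerWeight q p) (Γ t) ⇑(deriv Γ t) ⇑(deriv Γ t))) := by
        refine lintegral_mono fun t => ?_
        rw [← enorm_eq_nnnorm, ← ofReal_norm, ← ofReal_norm, ← ENNReal.ofReal_mul (norm_nonneg _)]
        exact ENNReal.ofReal_le_ofReal (norm_deriv_curveLength_rpow_le q p hΓ h0 t)
    _ = ‖(p - 1) / 2‖₊ * ∫⁻ t in Icc (0 : ℝ) 1, ENNReal.ofReal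
        (√(sobolevMetric (powerWeight q p) (Γ t) ⇑(deriv Γ t) ⇑(deriv Γ t))) :=
        lintegral_const_mul' _ _ ENNReal.coe_ne_top
    _ ≤ _ := by
        rw [mul_comm]
        gcongr

/-- Curves whose length, raised to the power `(p - 1) / 2`, tends to zero do not converge. -/
theorem not_tendsto_of_curveLength_rpow_tendsto_zero {q p : ℝ} (hp : p ≠ 1)
    {c : ℕ → GeodesicSpace d (powerWeight q p)}
    (hc : Tendsto (fun n => curveLength (c n).curve ^ ((p - 1) / 2)) atTop (𝓝 0))
    (c' : GeodesicSpace d (powerWeight q p)) : ¬ Tendsto c atTop (𝓝 c') := by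
  intro h
  have h1 := ((lipschitzWith_curveLength_rpow q hp).continuous.tendsto c').comp h
  have h2 : 0 < curveLength c'.curve := SobolevTwo.curveLength_pos c'.toImmersion.2
  exact (Real.rpow_pos_of_pos h2 _).ne (tendsto_nhds_unique hc h1)

/-! ### The oscillating curves -/

/-- The vector `(x, y)` of the plane spanned by the first two coordinate axes of `ℝ^d`. -/
def planeVec (hd : 2 ≤ d) (x y : ℝ) : Euc d :=
  x • EuclideanSpace.single (⟨0, by lia⟩ : Fin d) (1 : ℝ)
    + y • EuclideanSpace.single (⟨1, by lia⟩ : Fin d) (1 : ℝ)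

theorem norm_planeVec_sq (hd : 2 ≤ d) (x y : ℝ) : ‖planeVec hd x y‖ ^ 2 = x ^ 2 + y ^ 2 := by
  have h : inner ℝ (EuclideanSpace.single (⟨0, by lia⟩ : Fin d) (1 : ℝ))
      (EuclideanSpace.single (⟨1, by lia⟩ : Fin d) (1 : ℝ)) = 0 := by
    rw [EuclideanSpace.inner_single_left]
    simp
  rw [planeVec, norm_add_sq_real, inner_smul_left, inner_smul_right, h]
  simp [norm_smul]

theorem abs_fst_le_norm_planeVec (hd : 2 ≤ d) (x y : ℝ) : |x| ≤ ‖planeVec hd x y‖ := by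
  refine abs_le_of_sq_le_sq ?_ (norm_nonneg _)
  rw [norm_planeVec_sq]
  nlinarith [sq_nonneg y]

theorem abs_snd_le_norm_planeVec (hd : 2 ≤ d) (x y : ℝ) : |y| ≤ ‖planeVec hd x y‖ := by
  refine abs_le_of_sq_le_sq ?_ (norm_nonneg _)
  rw [norm_planeVec_sq]
  nlinarith [sq_nonneg x]

theorem norm_planeVec_le (hd : 2 ≤ d) (x y : ℝ) : ‖planeVec hd x y‖ ≤ |x| + |y| := by
  refine abs_le_of_sq_le_sq' ?_ (by positivity) |>.2
  rw [norm_planeVec_sq, add_sq, sq_abs, sq_abs]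
  have := mul_nonneg (abs_nonneg x) (abs_nonneg y)
  linarith

theorem hasDerivAt_planeVec (hd : 2 ≤ d) {x y : ℝ → ℝ} {x' y' θ : ℝ} (hx : HasDerivAt x x' θ)
    (hy : HasDerivAt y y' θ) :
    HasDerivAt (fun θ => planeVec hd (x θ) (y θ)) (planeVec hd x' y') θ :=
  (hx.smul_const _).add (hy.smul_const _)

theorem isSobolevTwo_of_contDiff {f : ℝ → Euc d} (hf : ContDiff ℝ 2 f)
    (hp : Function.Periodic f (2 * Real.pi)) : IsSobolevTwo f where
  periodic := hp
  contDiff := hf.of_le one_le_two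
  primitive := by
    have h1 : ContDiff ℝ 1 (deriv f) := by
      have : ContDiff ℝ (1 + 1) f := by simpa [one_add_one_eq_two] using hf
      exact (contDiff_succ_iff_deriv.1 this).2.2
    have h2 : Continuous (deriv (deriv f)) := h1.continuous_deriv le_rfl
    obtain ⟨C, hC⟩ := isCompact_Icc.exists_bound_of_continuousOn
      (h2.continuousOn (s := Icc 0 (2 * Real.pi)))
    refine ⟨deriv (deriv f), MemLp.of_bound h2.aestronglyMeasurable C ?_, fun t _ => ?_⟩
    · rw [ae_restrict_iff' measurableSet_Ioc]
      filter_upwards with t ht using hC t (Ioc_subset_Icc_self ht)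
    · rw [intervalIntegral.integral_deriv_eq_sub
        (fun x _ => h1.differentiable one_ne_zero x) (h2.intervalIntegrable _ _)]
      abel

/-- The plane curve
`θ ↦ (A sin (2 M θ) / (2 M) + B sin (4 M θ) / (4 M), - b cos θ)`. -/
def wiggleFun (hd : 2 ≤ d) (M : ℕ) (A B b θ : ℝ) : Euc d :=
  planeVec hd (A / (2 * M) * Real.sin (2 * M * θ) + B / (4 * M) * Real.sin (4 * M * θ))
    (-b * Real.cos θ)

theorem isSobolevTwo_wiggleFun (hd : 2 ≤ d) (M : ℕ) (A B b : ℝ) :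
    IsSobolevTwo (wiggleFun hd M A B b) := by
  refine isSobolevTwo_of_contDiff ?_ fun θ => ?_
  · unfold wiggleFun planeVec
    fun_prop
  · have h1 : Real.sin (2 * M * (θ + 2 * Real.pi)) = Real.sin (2 * M * θ) := by
      rw [← Real.sin_add_nat_mul_two_pi (2 * M * θ) (2 * M)]
      push_cast
      ring_nf
    have h2 : Real.sin (4 * M * (θ + 2 * Real.pi)) = Real.sin (4 * M * θ) := by
      rw [← Real.sin_add_nat_mul_two_pi (4 * M * θ) (4 * M)]
      push_cast
      ring_nf
    rw [wiggleFun, wiggleFun, h1, h2, Real.cos_add_two_pi]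

/-- The curve `wiggleFun`, as an element of `H²(S¹, ℝ^d)`. -/
def wiggle (hd : 2 ≤ d) (M : ℕ) (A B b : ℝ) : SobolevTwo d :=
  ⟨wiggleFun hd M A B b, isSobolevTwo_wiggleFun hd M A B b⟩

theorem coe_wiggle (hd : 2 ≤ d) (M : ℕ) (A B b : ℝ) :
    (wiggle hd M A B b : ℝ → Euc d) = wiggleFun hd M A B b := rfl

theorem wiggle_add_smul (hd : 2 ≤ d) (M : ℕ) (A B b A' B' b' t : ℝ) :
    wiggle hd M A B b + t • wiggle hd M A' B' b'
      = wiggle hd M (A + t * A') (B + t * B') (b + t * b') := by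
  refine SobolevTwo.ext_of fun θ => ?_
  rw [SobolevTwo.coe_add, SobolevTwo.coe_smul]
  simp only [coe_wiggle, Pi.add_apply, Pi.smul_apply, wiggleFun, planeVec]
  module

/-- Doubling the frequency moves the amplitude to the second harmonic. -/
theorem wiggle_two_mul (hd : 2 ≤ d) (M : ℕ) (A b : ℝ) :
    wiggle hd (2 * M) A 0 b = wiggle hd M 0 A b := by
  refine SobolevTwo.ext_of fun θ => ?_
  simp only [coe_wiggle, wiggleFun]
  push_cast
  congr 1
  rw [show (2 : ℝ) * (2 * M) = 4 * M by ring]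
  ring

theorem hasDerivAt_wiggle (hd : 2 ≤ d) {M : ℕ} (hM : 1 ≤ M) (A B b θ : ℝ) :
    HasDerivAt (wiggle hd M A B b)
      (planeVec hd (A * Real.cos (2 * M * θ) + B * Real.cos (4 * M * θ)) (b * Real.sin θ)) θ := by
  have hM' : (M : ℝ) ≠ 0 := by positivity
  rw [coe_wiggle]
  refine hasDerivAt_planeVec hd ?_ ?_
  · have h1 := (((hasDerivAt_id θ).const_mul (2 * (M : ℝ))).sin.const_mul (A / (2 * M))).add
      (((hasDerivAt_id θ).const_mul (4 * (M : ℝ))).sin.const_mul (B / (4 * M)))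
    refine h1.congr_deriv ?_
    simp only [id]
    field_simp
  · refine ((Real.hasDerivAt_cos θ).const_mul (-b)).congr_deriv ?_
    ring

theorem deriv_wiggle (hd : 2 ≤ d) {M : ℕ} (hM : 1 ≤ M) (A B b : ℝ) :
    deriv (wiggle hd M A B b) = fun θ =>
      planeVec hd (A * Real.cos (2 * M * θ) + B * Real.cos (4 * M * θ)) (b * Real.sin θ) :=
  funext fun θ => (hasDerivAt_wiggle hd hM A B b θ).deriv

theorem hasDerivAt_deriv_wiggle (hd : 2 ≤ d) {M : ℕ} (hM : 1 ≤ M) (A B b θ : ℝ) :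
    HasDerivAt (deriv (wiggle hd M A B b))
      (planeVec hd (-(2 * M * A * Real.sin (2 * M * θ)) - 4 * M * B * Real.sin (4 * M * θ))
        (b * Real.cos θ)) θ := by
  rw [deriv_wiggle hd hM]
  refine hasDerivAt_planeVec hd ?_ ((Real.hasDerivAt_sin θ).const_mul b)
  have h1 := (((hasDerivAt_id θ).const_mul (2 * (M : ℝ))).cos.const_mul A).add
    (((hasDerivAt_id θ).const_mul (4 * (M : ℝ))).cos.const_mul B)
  refine h1.congr_deriv ?_
  simp only [id]
  ring

/-! ### Size of the oscillating curves -/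

theorem abs_mul_le_of_abs_le_one {x y : ℝ} (hy : |y| ≤ 1) : |x * y| ≤ |x| := by
  rw [abs_mul]
  exact mul_le_of_le_one_right (abs_nonneg x) hy

theorem norm_wiggle_le (hd : 2 ≤ d) {M : ℕ} {A B b K a : ℝ} (hM : 1 ≤ M) (hA : |A| ≤ K * a)
    (hB : |B| ≤ K * a) (hb : |b| ≤ K * a / M) (θ : ℝ) :
    ‖wiggle hd M A B b θ‖ ≤ 2 * K * a / M := by
  have hM' : (0 : ℝ) < M := by positivity
  have hKa : 0 ≤ K * a := (abs_nonneg A).trans hA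
  refine (norm_planeVec_le hd _ _).trans ?_
  have h1 := abs_mul_le_of_abs_le_one (x := A / (2 * M)) (Real.abs_sin_le_one (2 * M * θ))
  have h2 := abs_mul_le_of_abs_le_one (x := B / (4 * M)) (Real.abs_sin_le_one (4 * M * θ))
  have h3 := abs_mul_le_of_abs_le_one (x := -b) (Real.abs_cos_le_one θ)
  have h4 := abs_add_le (A / (2 * M) * Real.sin (2 * M * θ)) (B / (4 * M) * Real.sin (4 * M * θ))
  rw [abs_div, abs_of_pos (by positivity : (0 : ℝ) < 2 * M)] at h1
  rw [abs_div, abs_of_pos (by positivity : (0 : ℝ) < 4 * M)] at h2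
  rw [abs_neg] at h3
  have h5 : |A| / (2 * M) ≤ K * a / (2 * M) := by gcongr
  have h6 : |B| / (4 * M) ≤ K * a / (4 * M) := by gcongr
  have h7 : 0 ≤ K * a / M := by positivity
  have h8 : K * a / (2 * M) = 1 / 2 * (K * a / M) := by field_simp
  have h9 : K * a / (4 * M) = 1 / 4 * (K * a / M) := by field_simp
  have h10 : 2 * K * a / M = 2 * (K * a / M) := by ring
  linarith

theorem norm_deriv_wiggle_le (hd : 2 ≤ d) {M : ℕ} {A B b K a : ℝ} (hM : 1 ≤ M)
    (hA : |A| ≤ K * a) (hB : |B| ≤ K * a) (hb : |b| ≤ K * a / M) (θ : ℝ) :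
    ‖deriv (wiggle hd M A B b) θ‖ ≤ 3 * K * a := by
  have hM' : (1 : ℝ) ≤ M := by exact_mod_cast hM
  have hKa : 0 ≤ K * a := (abs_nonneg A).trans hA
  rw [deriv_wiggle hd hM]
  refine (norm_planeVec_le hd _ _).trans ?_
  have h1 := abs_mul_le_of_abs_le_one (x := A) (Real.abs_cos_le_one (2 * M * θ))
  have h2 := abs_mul_le_of_abs_le_one (x := B) (Real.abs_cos_le_one (4 * M * θ))
  have h3 := abs_mul_le_of_abs_le_one (x := b) (Real.abs_sin_le_one θ)
  have h4 := abs_add_le (A * Real.cos (2 * M * θ)) (B * Real.cos (4 * M * θ))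
  have h5 : K * a / M ≤ K * a := div_le_self hKa hM'
  linarith

/-- The vector on the left is the second derivative, by `hasDerivAt_deriv_wiggle`. -/
theorem norm_deriv_deriv_wiggle_le (hd : 2 ≤ d) {M : ℕ} {A B b K a : ℝ} (hM : 1 ≤ M)
    (hA : |A| ≤ K * a) (hB : |B| ≤ K * a) (hb : |b| ≤ K * a / M) (θ : ℝ) :
    ‖planeVec hd (-(2 * M * A * Real.sin (2 * M * θ)) - 4 * M * B * Real.sin (4 * M * θ))
        (b * Real.cos θ)‖ ≤ 7 * K * a * M := by
  have hM' : (1 : ℝ) ≤ M := by exact_mod_cast hM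
  have hKa : 0 ≤ K * a := (abs_nonneg A).trans hA
  refine (norm_planeVec_le hd _ _).trans ?_
  have h1 := abs_mul_le_of_abs_le_one (x := 2 * M * A) (Real.abs_sin_le_one (2 * M * θ))
  have h2 := abs_mul_le_of_abs_le_one (x := 4 * M * B) (Real.abs_sin_le_one (4 * M * θ))
  have h3 := abs_mul_le_of_abs_le_one (x := b) (Real.abs_cos_le_one θ)
  have h4 := abs_sub (-(2 * M * A * Real.sin (2 * M * θ))) (4 * M * B * Real.sin (4 * M * θ))
  rw [abs_neg] at h4
  have h6 : |2 * M * A| ≤ 2 * M * (K * a) := by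
    rw [abs_mul, abs_of_pos (by positivity : (0 : ℝ) < 2 * M)]
    gcongr
  have h7 : |4 * M * B| ≤ 4 * M * (K * a) := by
    rw [abs_mul, abs_of_pos (by positivity : (0 : ℝ) < 4 * M)]
    gcongr
  have h5 : K * a / M ≤ K * a := div_le_self hKa hM'
  have h8 : K * a ≤ K * a * M := le_mul_of_one_le_right hKa hM'
  linarith

theorem abs_sin_nat_mul_le (n : ℕ) (θ : ℝ) : |Real.sin (n * θ)| ≤ n * |Real.sin θ| := by
  induction n with
  | zero => simp
  | succ k ih =>
    push_cast
    rw [add_mul, one_mul, Real.sin_add]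
    have h1 : |Real.sin (k * θ) * Real.cos θ| ≤ |Real.sin (k * θ)| :=
      abs_mul_le_of_abs_le_one (Real.abs_cos_le_one θ)
    have h2 : |Real.cos (k * θ) * Real.sin θ| ≤ |Real.sin θ| := by
      rw [mul_comm]
      exact abs_mul_le_of_abs_le_one (Real.abs_cos_le_one (k * θ))
    have h3 := abs_add_le (Real.sin (k * θ) * Real.cos θ) (Real.cos (k * θ) * Real.sin θ)
    linarith

/-- At the zeros of `sin θ` both harmonics of the first velocity component equal one, so the two
velocity components are never small together. -/
theorem le_norm_deriv_wiggle (hd : 2 ≤ d) {M : ℕ} {A B b κ a : ℝ} (hM : 1 ≤ M) (hκ : 0 < κ)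
    (ha : 0 < a) (hA : 0 ≤ A) (hB : 0 ≤ B) (hAB : κ * a ≤ A + B) (hb : κ * a / M ≤ b) (θ : ℝ) :
    κ * a / (4 * M ^ 2) ≤ ‖deriv (wiggle hd M A B b) θ‖ := by
  have hM' : (1 : ℝ) ≤ M := by exact_mod_cast hM
  have hM2 : (1 : ℝ) ≤ (M : ℝ) ^ 2 := one_le_pow₀ hM'
  have hκa : 0 < κ * a := mul_pos hκ ha
  rw [deriv_wiggle hd hM]
  set s := Real.sin (M * θ) with hs
  have h2 : Real.cos (2 * M * θ) = 1 - 2 * s ^ 2 := by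
    rw [mul_assoc, Real.cos_two_mul, Real.cos_sq', hs]
    ring
  have h4 : Real.cos (4 * M * θ) = 1 - 8 * s ^ 2 + 8 * s ^ 4 := by
    rw [show 4 * M * θ = 2 * (2 * M * θ) by ring, Real.cos_two_mul, h2]
    ring
  rcases le_total (s ^ 2) (1 / 16) with hs' | hs'
  · refine le_trans ?_ ((le_abs_self _).trans (abs_fst_le_norm_planeVec hd _ _))
    have h5 : κ * a / (4 * M ^ 2) ≤ κ * a / 4 := by
      gcongr
      linarith
    have h6 : A * (1 / 2) ≤ A * Real.cos (2 * M * θ) := by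
      rw [h2]
      gcongr
      linarith
    have h7 : B * (1 / 2) ≤ B * Real.cos (4 * M * θ) := by
      rw [h4]
      gcongr
      have : 0 ≤ s ^ 4 := by positivity
      linarith
    linarith
  · refine le_trans ?_ (abs_snd_le_norm_planeVec hd _ _)
    have hb0 : 0 < b := lt_of_lt_of_le (by positivity) hb
    have h5 : 1 / 4 ≤ |s| := by
      refine abs_le_of_sq_le_sq' ?_ (abs_nonneg s) |>.2
      rw [sq_abs]
      linarith
    have h6 := h5.trans (abs_sin_nat_mul_le M θ)
    rw [abs_mul, abs_of_pos hb0]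
    calc κ * a / (4 * M ^ 2) = κ * a / M * (1 / 4 / M) := by field_simp
      _ ≤ b * |Real.sin θ| := by
        gcongr
        rw [div_le_iff₀ (by positivity)]
        linarith

theorem integral_cos_nat_mul {k : ℕ} (hk : k ≠ 0) :
    ∫ θ in (0 : ℝ)..(2 * Real.pi), Real.cos (k * θ) = 0 := by
  have hk' : (k : ℝ) ≠ 0 := by exact_mod_cast hk
  rw [intervalIntegral.integral_comp_mul_left _ hk', integral_cos]
  have : Real.sin (k * (2 * Real.pi)) = 0 := by
    have := Real.sin_nat_mul_pi (2 * k)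
    push_cast at this
    rw [← this]
    ring_nf
  simp [this]

theorem le_curveLength_wiggle (hd : 2 ≤ d) {M : ℕ} {A B b : ℝ} (hM : 1 ≤ M) (hA : 0 ≤ A)
    (hB : 0 ≤ B) : A + B ≤ curveLength (wiggle hd M A B b) := by
  have hI : ∀ k : ℕ, IntervalIntegrable (fun θ : ℝ => Real.cos (k * θ)) volume 0
      (2 * Real.pi) := fun k => by
    refine Continuous.intervalIntegrable ?_ _ _
    fun_prop
  have h1 : ∫ θ in (0 : ℝ)..(2 * Real.pi), ((A + B) / 4 + ((A + B) / 4 * Real.cos ((2 * M : ℕ) * θ)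
      + A / 4 * Real.cos ((4 * M : ℕ) * θ) + (A + B) / 4 * Real.cos ((6 * M : ℕ) * θ)
      + B / 4 * Real.cos ((8 * M : ℕ) * θ))) = Real.pi / 2 * (A + B) := by
    rw [intervalIntegral.integral_add (by simp)
        (by refine Continuous.intervalIntegrable ?_ _ _; fun_prop),
      intervalIntegral.integral_add (((((hI _).const_mul _).add ((hI _).const_mul _))).add
        ((hI _).const_mul _)) ((hI _).const_mul _),
      intervalIntegral.integral_add (((hI _).const_mul _).add ((hI _).const_mul _))
        ((hI _).const_mul _),
      intervalIntegral.integral_add ((hI _).const_mul _) ((hI _).const_mul _)]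
    simp only [intervalIntegral.integral_const_mul]
    rw [integral_cos_nat_mul (by lia), integral_cos_nat_mul (by lia),
      integral_cos_nat_mul (by lia), integral_cos_nat_mul (by lia)]
    simp only [intervalIntegral.integral_const, smul_eq_mul]
    ring
  -- The trigonometric polynomial above is the first velocity component times
  -- `(cos (2 M θ) + cos (4 M θ)) / 2`, a factor bounded by one.
  have h2 : Real.pi / 2 * (A + B) ≤ curveLength (wiggle hd M A B b) := by
    rw [← h1, curveLength]
    refine intervalIntegral.integral_mono_on two_pi_nonneg
      (by refine Continuous.intervalIntegrable ?_ _ _; fun_prop)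
      ((wiggle hd M A B b).continuous_deriv.norm.intervalIntegrable _ _) fun θ _ => ?_
    rw [deriv_wiggle hd hM]
    refine le_trans ?_ (abs_fst_le_norm_planeVec hd _ _)
    set φ := 2 * M * θ with hφ
    have e4 : 4 * M * θ = 2 * φ := by rw [hφ]; ring
    have e4' : ((4 * M : ℕ) : ℝ) * θ = 2 * φ := by rw [hφ]; push_cast; ring
    have e2 : ((2 * M : ℕ) : ℝ) * θ = φ := by rw [hφ]; push_cast; ring
    have e6 : ((6 * M : ℕ) : ℝ) * θ = 3 * φ := by rw [hφ]; push_cast; ring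
    have e8 : ((8 * M : ℕ) : ℝ) * θ = 2 * (2 * φ) := by rw [hφ]; push_cast; ring
    rw [e4, e4', e2, e6, e8, Real.cos_three_mul, Real.cos_two_mul (2 * φ), Real.cos_two_mul φ]
    set z := Real.cos φ with hz
    have h3 : |(z + (2 * z ^ 2 - 1)) / 2| ≤ 1 := by
      have := Real.abs_cos_le_one φ
      have h4 := Real.abs_cos_le_one (2 * φ)
      rw [Real.cos_two_mul] at h4
      rw [abs_div, abs_two, div_le_one two_pos]
      exact (abs_add_le _ _).trans (by linarith)
    refine le_trans ?_ (abs_mul_le_of_abs_le_one (x := A * z + B * (2 * z ^ 2 - 1)) h3)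
    refine le_trans (le_of_eq ?_) (le_abs_self _)
    ring
  have h3 : 1 * (A + B) ≤ Real.pi / 2 * (A + B) := by
    gcongr
    linarith [Real.two_le_pi]
  linarith

theorem curveLength_le {c : SobolevTwo d} {K : ℝ} (hK : ∀ θ, ‖deriv c θ‖ ≤ K) :
    curveLength c ≤ 2 * Real.pi * K := by
  have h := intervalIntegral.integral_mono_on two_pi_nonneg
    (c.continuous_deriv.norm.intervalIntegrable _ _)
    (intervalIntegrable_const (μ := volume) (c := K)) fun θ _ => hK θ
  simpa [curveLength] using h

/-! ### Energy of the segments between oscillating curves -/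

theorem sobolevMetric_powerWeight_le (q p : ℝ) {c h : ℝ → Euc d} {S D K : ℝ}
    (hl : 0 < curveLength c) (hS : ∀ θ, ‖h θ‖ ≤ S) (hD : ∀ θ, ‖arcDeriv c (arcDeriv c h) θ‖ ≤ D)
    (hK : ∀ θ, ‖deriv c θ‖ ≤ K) :
    sobolevMetric (powerWeight q p) c h h
      ≤ (curveLength c ^ q * S ^ 2 + curveLength c ^ p * D ^ 2) * K * (2 * Real.pi) := by
  have hS0 := (norm_nonneg _).trans (hS 0)
  have hD0 := (norm_nonneg _).trans (hD 0)
  refine (le_abs_self _).trans ?_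
  have h1 := intervalIntegral.norm_integral_le_of_norm_le_const (a := 0) (b := 2 * Real.pi)
    (f := fun θ => (∑ j : Fin 3, powerWeight q p j (curveLength c) *
      inner ℝ ((arcDeriv c)^[j] h θ) ((arcDeriv c)^[j] h θ)) * ‖deriv c θ‖)
    (C := (curveLength c ^ q * S ^ 2 + curveLength c ^ p * D ^ 2) * K) fun θ _ => by
      rw [Fin.sum_univ_three]
      simp only [real_inner_self_eq_norm_sq, Fin.val_zero, Fin.val_one, Fin.val_two,
        Function.iterate_succ_apply', Function.iterate_zero, id, powerWeight, Matrix.cons_val,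
        zero_mul, add_zero]
      rw [Real.norm_of_nonneg (by positivity)]
      have := hS θ
      have := hD θ
      have := hK θ
      gcongr
  rwa [sub_zero, abs_of_pos Real.two_pi_pos] at h1

/-- Powers of comparable positive numbers are comparable. -/
theorem rpow_le_of_mem_Icc {κ L a ℓ : ℝ} (hκ : 0 < κ) (ha : 0 < a)
    (h1 : κ * a ≤ ℓ) (h2 : ℓ ≤ L * a) (s : ℝ) : ℓ ^ s ≤ (κ ^ s + L ^ s) * a ^ s := by
  have hl : 0 < ℓ := lt_of_lt_of_le (by positivity) h1
  have hL : 0 < L := pos_of_mul_pos_left (hl.trans_le h2) ha.le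
  rw [add_mul, ← Real.mul_rpow hκ.le ha.le, ← Real.mul_rpow hL.le ha.le]
  rcases le_total 0 s with hs | hs
  · have := Real.rpow_le_rpow hl.le h2 hs
    have : 0 ≤ (κ * a) ^ s := by positivity
    linarith
  · have := Real.rpow_le_rpow_of_nonpos (by positivity) h1 hs
    have : 0 ≤ (L * a) ^ s := by positivity
    linarith

/-- The energy of a variation within the family of oscillating curves. The first summand comes from
the zeroth order term of weight `ℓ ^ (-3)`, the second one from the second order term. -/
theorem exists_sobolevMetric_wiggle_le (hd : 2 ≤ d) (p : ℝ) {κ K : ℝ} (hκ : 0 < κ) (hK : 0 < K) :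
    ∃ C : ℝ, 0 ≤ C ∧ ∀ (M : ℕ) (a A B b A' B' b' : ℝ), 1 ≤ M → 0 < a → 0 ≤ A → 0 ≤ B →
      κ * a ≤ A + B → κ * a / M ≤ b → A ≤ K * a → B ≤ K * a → b ≤ K * a / M →
      |A'| ≤ K * a → |B'| ≤ K * a → |b'| ≤ K * a / M →
      sobolevMetric (powerWeight (-3) p) (wiggle hd M A B b) (wiggle hd M A' B' b')
        (wiggle hd M A' B' b') ≤ C * (1 / (M : ℝ) ^ 2 + a ^ (p - 1) * (M : ℝ) ^ 14) := by
  set C₁ := 112 * K / κ ^ 2 + 1344 * K ^ 2 / κ ^ 3 with hC₁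
  set P := κ ^ p + (6 * Real.pi * K) ^ p with hP
  have hP0 : 0 ≤ P := by positivity
  have hC₁0 : 0 ≤ C₁ := by positivity
  refine ⟨24 * Real.pi * K ^ 3 / κ ^ 3 + 6 * Real.pi * K * P * C₁ ^ 2, by positivity, ?_⟩
  intro M a A B b A' B' b' hM ha hA hB hAB hb hAK hBK hbK hA' hB' hb'
  have hM' : (1 : ℝ) ≤ M := by exact_mod_cast hM
  have hM0 : (0 : ℝ) < M := by linarith
  have hb0 : 0 ≤ b := le_trans (by positivity) hb
  rw [← abs_of_nonneg hA] at hAK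
  rw [← abs_of_nonneg hB] at hBK
  rw [← abs_of_nonneg hb0] at hbK
  set c := wiggle hd M A B b with hc
  set h := wiggle hd M A' B' b' with hh
  have hm : 0 < κ * a / (4 * (M : ℝ) ^ 2) := by positivity
  have hl1 : κ * a ≤ curveLength c := hAB.trans (le_curveLength_wiggle hd hM hA hB)
  have hl2 : curveLength c ≤ 6 * Real.pi * K * a := by
    refine (curveLength_le (norm_deriv_wiggle_le hd hM hAK hBK hbK)).trans (le_of_eq ?_)
    ring
  have hl : 0 < curveLength c := lt_of_lt_of_le (by positivity) hl1
  have hD : ∀ θ, ‖arcDeriv c (arcDeriv c h) θ‖ ≤ C₁ * (M : ℝ) ^ 7 / a := fun θ => by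
    refine (norm_arcDeriv_arcDeriv_le (hasDerivAt_deriv_wiggle hd hM A B b θ)
      (hasDerivAt_deriv_wiggle hd hM A' B' b' θ) hm
      (le_norm_deriv_wiggle hd hM hκ ha hA hB hAB hb θ)
      (norm_deriv_deriv_wiggle_le hd hM hAK hBK hbK θ)
      (norm_deriv_wiggle_le hd hM hA' hB' hb' θ)
      (norm_deriv_deriv_wiggle_le hd hM hA' hB' hb' θ)).trans ?_
    have e : 7 * K * a * M / (κ * a / (4 * (M : ℝ) ^ 2)) ^ 2
        + 3 * K * a * (7 * K * a * M) / (κ * a / (4 * (M : ℝ) ^ 2)) ^ 3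
        = 112 * K / κ ^ 2 * (M : ℝ) ^ 5 / a + 1344 * K ^ 2 / κ ^ 3 * (M : ℝ) ^ 7 / a := by
      field_simp
      ring
    rw [e, hC₁, add_mul, add_div]
    gcongr
    norm_num
  have hmet := sobolevMetric_powerWeight_le (-3) p hl (norm_wiggle_le hd hM hA' hB' hb') hD
    (norm_deriv_wiggle_le hd hM hAK hBK hbK)
  have h3 : curveLength c ^ (-3 : ℝ) ≤ 1 / (κ * a) ^ 3 := by
    have h4 := Real.rpow_le_rpow_of_nonpos (by positivity) hl1 (by norm_num : (-3 : ℝ) ≤ 0)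
    have h5 : (κ * a) ^ (-3 : ℝ) = 1 / (κ * a) ^ 3 := by
      rw [Real.rpow_neg (by positivity), one_div]
      norm_cast
    rwa [h5] at h4
  have h6 : curveLength c ^ p ≤ P * a ^ p := rpow_le_of_mem_Icc hκ ha hl1 hl2 p
  have h7 : a ^ p = a ^ (p - 1) * a := by
    rw [Real.rpow_sub_one ha.ne']
    field_simp
  have hq : 0 < a ^ (p - 1) := Real.rpow_pos_of_pos ha _
  calc _ ≤ _ := hmet
    _ ≤ (1 / (κ * a) ^ 3 * (2 * K * a / M) ^ 2 + P * a ^ p * (C₁ * (M : ℝ) ^ 7 / a) ^ 2)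
        * (3 * K * a) * (2 * Real.pi) := by gcongr
    _ = 24 * Real.pi * K ^ 3 / κ ^ 3 * (1 / (M : ℝ) ^ 2)
        + 6 * Real.pi * K * P * C₁ ^ 2 * (a ^ (p - 1) * (M : ℝ) ^ 14) := by
      rw [h7]
      field_simp
      ring
    _ ≤ _ := by
      have g1 : 0 ≤ 24 * Real.pi * K ^ 3 / κ ^ 3 * (a ^ (p - 1) * (M : ℝ) ^ 14) := by positivity
      have g2 : 0 ≤ 6 * Real.pi * K * P * C₁ ^ 2 * (1 / (M : ℝ) ^ 2) := by positivity
      linarith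

/-! ### The Cauchy sequences -/

theorem wiggle_mem_immersion (hd : 2 ≤ d) {M : ℕ} {A B b : ℝ} (hM : 1 ≤ M) (hA : 0 ≤ A)
    (hB : 0 ≤ B) (hAB : 0 < A + B) (hb : 0 < b) : wiggle hd M A B b ∈ SobolevImmersion d := by
  have hM0 : (0 : ℝ) < M := by positivity
  intro θ
  have hκ : 0 < min (A + B) (b * M) := lt_min hAB (by positivity)
  have h := le_norm_deriv_wiggle hd hM hκ one_pos hA hB
    (by rw [mul_one]; exact min_le_left _ _)
    (by rw [mul_one, div_le_iff₀ hM0]; exact min_le_right _ _) θ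
  exact norm_pos_iff.1 (lt_of_lt_of_le (by positivity) h)

/-- The growth factor of the lengths of the oscillating curves. It satisfies
`growth p ^ (p - 1) = 2 ^ (-16)`, which makes up for the factor `M ^ 14` in the second order energy
when `M` doubles. -/
def growth (p : ℝ) : ℝ := 2 ^ (-16 / (p - 1))

theorem growth_pos (p : ℝ) : 0 < growth p := Real.rpow_pos_of_pos two_pos _

theorem growth_pow_rpow {p : ℝ} (hp : p ≠ 1) (n : ℕ) :
    (growth p ^ n) ^ ((p - 1) / 2) = (1 / 2 ^ 8) ^ n := by
  have h0 : p - 1 ≠ 0 := sub_ne_zero.2 hp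
  rw [← Real.rpow_natCast (growth p), ← Real.rpow_mul (growth_pos p).le, mul_comm (n : ℝ),
    Real.rpow_mul (growth_pos p).le, Real.rpow_natCast]
  congr 1
  rw [growth, ← Real.rpow_mul two_pos.le,
    show -16 / (p - 1) * ((p - 1) / 2) = -((8 : ℕ) : ℝ) by push_cast; field_simp; norm_num,
    Real.rpow_neg two_pos.le, Real.rpow_natCast, one_div]

/-- The `n`-th curve oscillates with frequency `2 ^ (n + 1)` and has length comparable to
`growth p ^ n`. -/
def oscillatingCurve (hd : 2 ≤ d) (p : ℝ) (n : ℕ) : GeodesicSpace d (powerWeight (-3) p) :=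
  (⟨wiggle hd (2 ^ n) (growth p ^ n) 0 (growth p ^ n / 2 ^ n),
    wiggle_mem_immersion hd Nat.one_le_two_pow (pow_pos (growth_pos p) n).le le_rfl
      (by simpa using pow_pos (growth_pos p) n)
      (div_pos (pow_pos (growth_pos p) n) (by positivity))⟩ : SobolevImmersion d)

theorem curve_oscillatingCurve (hd : 2 ≤ d) (p : ℝ) (n : ℕ) :
    (oscillatingCurve hd p n).curve
      = wiggle hd (2 ^ n) (growth p ^ n) 0 (growth p ^ n / 2 ^ n) := rfl

theorem le_curveLength_oscillatingCurve (hd : 2 ≤ d) (p : ℝ) (n : ℕ) :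
    growth p ^ n ≤ curveLength (oscillatingCurve hd p n).curve := by
  have h := le_curveLength_wiggle hd (M := 2 ^ n) (b := growth p ^ n / 2 ^ n)
    Nat.one_le_two_pow (pow_pos (growth_pos p) n).le le_rfl
  rwa [add_zero] at h

theorem curveLength_oscillatingCurve_le (hd : 2 ≤ d) (p : ℝ) (n : ℕ) :
    curveLength (oscillatingCurve hd p n).curve ≤ 6 * Real.pi * growth p ^ n := by
  have ha := pow_pos (growth_pos p) n
  have h := curveLength_le (norm_deriv_wiggle_le hd (M := 2 ^ n) (A := growth p ^ n) (B := 0)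
    (b := growth p ^ n / 2 ^ n) (K := 1) (a := growth p ^ n) Nat.one_le_two_pow
    (by rw [one_mul, abs_of_pos ha]) (by simpa using ha.le)
    (by rw [abs_of_pos (by positivity)]; simp))
  rw [curve_oscillatingCurve]
  linarith

theorem exists_edist_oscillatingCurve_le (hd : 2 ≤ d) {p : ℝ} (hp : p ≠ 1) :
    ∃ C : ℝ, ∀ n, edist (oscillatingCurve hd p n) (oscillatingCurve hd p (n + 1))
      ≤ ENNReal.ofReal C / 2 ^ n := by
  have hl := growth_pos p
  set l := growth p with hl_def
  -- Along the segment `A + B` runs from `a` to `l * a`, and `b` from `a / M` to `l * a / (2 * M)`;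
  -- the latter accounts for the factor `1 / 2`.
  set κ := min 1 l / 2 with hκ_def
  have hκ : 0 < κ := by positivity
  have hκ1 : 2 * κ ≤ 1 := by linarith [min_le_left 1 l]
  have hκl : 2 * κ ≤ l := by linarith [min_le_right 1 l]
  obtain ⟨C, hC0, hC⟩ := exists_sobolevMetric_wiggle_le hd p hκ (by positivity : 0 < 1 + l)
  refine ⟨√(2 * C), fun n => ?_⟩
  have hM : 1 ≤ 2 ^ n := Nat.one_le_two_pow
  set a := l ^ n with ha_def
  have ha : 0 < a := pow_pos hl n
  set β := a / 2 ^ n with hβ_def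
  have hβ : 0 < β := by positivity
  have hβM : a / ((2 ^ n : ℕ) : ℝ) = β := by rw [hβ_def]; norm_cast
  have hnext : wiggle hd (2 ^ (n + 1)) (l ^ (n + 1)) 0 (l ^ (n + 1) / 2 ^ (n + 1))
      = wiggle hd (2 ^ n) a 0 β + wiggle hd (2 ^ n) (-a) (l * a) (l / 2 * β - β) := by
    rw [pow_succ' 2 n, wiggle_two_mul,
      ← one_smul ℝ (wiggle hd (2 ^ n) (-a) (l * a) (l / 2 * β - β)), wiggle_add_smul]
    congr 1
    · ring
    · rw [ha_def]; ring
    · rw [hβ_def, ha_def]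
      field_simp
      ring
  have hn : ENNReal.ofReal (√(2 * C)) / 2 ^ n = ENNReal.ofReal (√(2 * C) / 2 ^ n) := by
    rw [ENNReal.ofReal_div_of_pos (by positivity), ENNReal.ofReal_pow two_pos.le,
      ENNReal.ofReal_ofNat]
  rw [hn]
  have hA : ∀ t ∈ Icc (0 : ℝ) 1, 0 ≤ a + t * -a ∧ a + t * -a ≤ (1 + l) * a := fun t ht => by
    have := ht.1
    have := sub_nonneg.2 ht.2
    constructor
    · calc 0 ≤ a * (1 - t) := by positivity
        _ = _ := by ring
    · have : 0 ≤ a * l + a * t := by positivity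
      linarith
  have hB : ∀ t ∈ Icc (0 : ℝ) 1, 0 ≤ 0 + t * (l * a) ∧ 0 + t * (l * a) ≤ (1 + l) * a :=
    fun t ht => by
      have := ht.1
      have := sub_nonneg.2 ht.2
      constructor
      · positivity
      · have : 0 ≤ a + (1 - t) * (l * a) := by positivity
        linarith
  have hAB : ∀ t ∈ Icc (0 : ℝ) 1, κ * a ≤ a + t * -a + (0 + t * (l * a)) := fun t ht => by
    have h1 := ht.1
    have h2 := sub_nonneg.2 ht.2
    have h3 : κ * a ≤ 2 * κ * a := by linarith [mul_pos hκ ha]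
    have h4 : (1 - t) * (2 * κ) * a ≤ (1 - t) * 1 * a := by gcongr
    have h5 : t * (2 * κ) * a ≤ t * l * a := by gcongr
    linarith
  have hb : ∀ t ∈ Icc (0 : ℝ) 1, κ * β ≤ β + t * (l / 2 * β - β) ∧
      β + t * (l / 2 * β - β) ≤ (1 + l) * β := fun t ht => by
    have h1 := ht.1
    have h2 := sub_nonneg.2 ht.2
    constructor
    · have h4 : (1 - t) * (2 * κ) * β ≤ (1 - t) * 1 * β := by gcongr
      have h5 : t * (2 * κ) * β ≤ t * l * β := by gcongr
      have h6 : 0 ≤ (1 - t) * κ * β := by positivity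
      linarith
    · have h5 : 0 ≤ (1 - t) * l * β := by positivity
      have h6 : 0 ≤ t * β := by positivity
      have h7 : 0 ≤ l * β := by positivity
      linarith
  refine geodesicEDist_le_of_segment (h := wiggle hd (2 ^ n) (-a) (l * a) (l / 2 * β - β))
    hnext ?_ ?_
  · intro t ht
    change wiggle hd (2 ^ n) a 0 β + t • _ ∈ _
    rw [wiggle_add_smul]
    exact wiggle_mem_immersion hd hM (hA t ht).1 (hB t ht).1
      (lt_of_lt_of_le (by positivity) (hAB t ht)) (lt_of_lt_of_le (by positivity) (hb t ht).1)
  · intro t ht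
    change √(sobolevMetric _ ⇑(wiggle hd (2 ^ n) a 0 β + t • _) _ _) ≤ _
    rw [wiggle_add_smul]
    have h := hC (2 ^ n) a (a + t * -a) (0 + t * (l * a)) (β + t * (l / 2 * β - β))
      (-a) (l * a) (l / 2 * β - β) hM ha (hA t ht).1 (hB t ht).1 (hAB t ht) (by rw [mul_div_assoc, hβM]; exact (hb t ht).1) (hA t ht).2 (hB t ht).2
      (by rw [mul_div_assoc, hβM]; exact (hb t ht).2)
      (by rw [abs_neg, abs_of_pos ha]; nlinarith)
      (by rw [abs_of_pos (by positivity)]; nlinarith)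
      (by
        rw [mul_div_assoc, hβM, abs_le]
        have : 0 < l * β := by positivity
        constructor <;> linarith)
    refine Real.sqrt_le_iff.2 ⟨by positivity, h.trans (le_of_eq ?_)⟩
    have e : a ^ (p - 1) = ((1 / 2 ^ 8) ^ n) ^ 2 := by
      rw [← growth_pow_rpow hp n, ← hl_def, ← ha_def, ← Real.rpow_natCast (a ^ ((p - 1) / 2)),
        ← Real.rpow_mul ha.le]
      congr 1
      push_cast
      ring
    rw [e, div_pow (√(2 * C)), Real.sq_sqrt (by positivity)]
    push_cast
    have e1 : ((1 / 2 ^ 8 : ℝ) ^ n) ^ 2 * ((2 : ℝ) ^ n) ^ 14 = 1 / ((2 : ℝ) ^ n) ^ 2 := by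
      rw [div_pow, one_pow, ← pow_mul, mul_comm 8 n, pow_mul]
      field_simp
    rw [e1]
    ring

theorem cauchySeq_oscillatingCurve (hd : 2 ≤ d) {p : ℝ} (hp : p ≠ 1) :
    CauchySeq (oscillatingCurve hd p) := by
  obtain ⟨C, hC⟩ := exists_edist_oscillatingCurve_le hd hp
  exact cauchySeq_of_edist_le_geometric_two _ ENNReal.ofReal_ne_top hC

theorem not_tendsto_oscillatingCurve (hd : 2 ≤ d) {p : ℝ} (hp : p ≠ 1)
    (c' : GeodesicSpace d (powerWeight (-3) p)) :
    ¬ Tendsto (oscillatingCurve hd p) atTop (𝓝 c') := by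
  refine not_tendsto_of_curveLength_rpow_tendsto_zero hp ?_ c'
  have h1 : Tendsto (fun n : ℕ => ((1 : ℝ) ^ ((p - 1) / 2) + (6 * Real.pi) ^ ((p - 1) / 2))
      * (1 / 2 ^ 8) ^ n) atTop (𝓝 0) := by
    simpa using (tendsto_pow_atTop_nhds_zero_of_lt_one (by positivity)
      (by norm_num : (1 / 2 ^ 8 : ℝ) < 1)).const_mul
      ((1 : ℝ) ^ ((p - 1) / 2) + (6 * Real.pi) ^ ((p - 1) / 2))
  have ha := fun n => pow_pos (growth_pos p) n
  refine squeeze_zero (fun n => Real.rpow_nonneg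
    ((ha n).le.trans (le_curveLength_oscillatingCurve hd p n)) _) (fun n => ?_) h1
  rw [← growth_pow_rpow hp n]
  exact rpow_le_of_mem_Icc one_pos (ha n)
    (by rw [one_mul]; exact le_curveLength_oscillatingCurve hd p n)
    (curveLength_oscillatingCurve_le hd p n) _

theorem not_completeSpace_powerWeight (hd : 2 ≤ d) {p : ℝ} (hp : p ≠ 1) :
    ¬ CompleteSpace (GeodesicSpace d (powerWeight (-3) p)) := fun _ =>
  let ⟨c', hc'⟩ := cauchySeq_tendsto_of_complete (cauchySeq_oscillatingCurve hd hp)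
  not_tendsto_oscillatingCurve hd hp c' hc'

theorem tendsto_curveLength_atTop (hd : 2 ≤ d) {p : ℝ} (hp : p < 1) :
    Tendsto (fun n => curveLength (oscillatingCurve hd p n).curve) atTop atTop := by
  have h1 : 1 < growth p := Real.one_lt_rpow one_lt_two (div_pos_of_neg_of_neg (by norm_num)
    (by linarith))
  exact tendsto_atTop_mono (le_curveLength_oscillatingCurve hd p)
    (tendsto_pow_atTop_atTop_of_one_lt h1)

theorem tendsto_curveLength_zero (hd : 2 ≤ d) {p : ℝ} (hp : 1 < p) :
    Tendsto (fun n => curveLength (oscillatingCurve hd p n).curve) atTop (𝓝 0) := by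
  have h1 : growth p < 1 := Real.rpow_lt_one_of_one_lt_of_neg one_lt_two
    (div_neg_of_neg_of_pos (by norm_num) (by linarith))
  refine squeeze_zero (fun n => (pow_pos (growth_pos p) n).le.trans
    (le_curveLength_oscillatingCurve hd p n)) (curveLength_oscillatingCurve_le hd p) ?_
  simpa using (tendsto_pow_atTop_nhds_zero_of_lt_one (growth_pos p).le h1).const_mul
    (6 * Real.pi)

/-! ### The integral conditions for power weights -/

theorem isLengthWeight_powerWeight (q p : ℝ) : IsLengthWeight (powerWeight q p) where
  smooth j := by
    have h : ∀ s : ℝ, ContDiffOn ℝ ∞ (fun r : ℝ => r ^ s) (Ioi 0) := fun s r hr =>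
      (Real.contDiffAt_rpow_const_of_ne (ne_of_gt hr)).contDiffWithinAt
    fin_cases j
    · exact h q
    · exact contDiffOn_const
    · exact h p
  nonneg j r hr := powerWeight_nonneg q p j hr
  pos_zero r hr := Real.rpow_pos_of_pos hr q
  pos_two r hr := Real.rpow_pos_of_pos hr p

theorem integrand_powerWeight {r : ℝ} (hr : 0 < r) (k : ℕ) (s : ℝ) :
    r ^ (1 / 2 - (k : ℝ)) * √(r ^ s) = r ^ ((1 + s) / 2 - k) := by
  rw [Real.sqrt_eq_rpow, ← Real.rpow_mul hr.le, ← Real.rpow_add hr]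
  congr 1
  ring

theorem lintegral_Ioo_rpow_eq_top {s : ℝ} (hs : s ≤ -1) :
    ∫⁻ r in Ioo (0 : ℝ) 1, ENNReal.ofReal (r ^ s) = ⊤ := by
  by_contra h
  have hi : IntegrableOn (fun r : ℝ => r ^ s) (Ioo 0 1) := by
    refine ⟨(measurable_id.pow_const s).aestronglyMeasurable, ?_⟩
    rw [hasFiniteIntegral_iff_ofReal]
    · exact lt_top_iff_ne_top.2 h
    · exact (ae_restrict_iff' measurableSet_Ioo).2
        (.of_forall fun r hr => Real.rpow_nonneg hr.1.le s)
  have := (intervalIntegral.integrableOn_Ioo_rpow_iff one_pos).1 hi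
  linarith

theorem lintegral_Ioi_rpow_eq_top {s : ℝ} (hs : -1 ≤ s) :
    ∫⁻ r in Ioi (1 : ℝ), ENNReal.ofReal (r ^ s) = ⊤ := by
  by_contra h
  have hi : IntegrableOn (fun r : ℝ => r ^ s) (Ioi 1) := by
    refine ⟨(measurable_id.pow_const s).aestronglyMeasurable, ?_⟩
    rw [hasFiniteIntegral_iff_ofReal]
    · exact lt_top_iff_ne_top.2 h
    · exact (ae_restrict_iff' measurableSet_Ioi).2
        (.of_forall fun r hr => Real.rpow_nonneg (one_pos.le.trans hr.le) s)
  have := (integrableOn_Ioi_rpow_iff one_pos).1 hi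
  linarith

theorem integralZero_eq_top {a : Fin 3 → ℝ → ℝ} {k : Fin 3} {s : ℝ}
    (ha : ∀ r, a k r = r ^ s) (hs : (1 + s) / 2 - (k : ℕ) ≤ -1) : integralZero a k = ⊤ := by
  rw [← lintegral_Ioo_rpow_eq_top hs]
  refine setLIntegral_congr_fun measurableSet_Ioo fun r hr => ?_
  simp only [ha]
  rw [integrand_powerWeight hr.1]

theorem integralInfty_eq_top {a : Fin 3 → ℝ → ℝ} {k : Fin 3} {s : ℝ}
    (ha : ∀ r, a k r = r ^ s) (hs : -1 ≤ (1 + s) / 2 - (k : ℕ)) : integralInfty a k = ⊤ := by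
  rw [← lintegral_Ioi_rpow_eq_top hs]
  refine setLIntegral_congr_fun measurableSet_Ioi fun r hr => ?_
  simp only [ha]
  rw [integrand_powerWeight (one_pos.trans hr)]

end SobolevCurves

end

theorem mainTheorem3 (d : ℕ) (hd : 2 ≤ d) :
    (∀ p : ℝ, p < 1 →
      ¬ CompleteSpace (SobolevCurves.GeodesicSpace d (SobolevCurves.powerWeight (-3) p)) ∧
      ∃ c : ℕ → SobolevCurves.GeodesicSpace d (SobolevCurves.powerWeight (-3) p),
        CauchySeq c ∧ (∀ c', ¬ Tendsto c atTop (𝓝 c')) ∧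
        Tendsto (fun n => SobolevCurves.curveLength (c n).curve) atTop atTop) ∧
    (∀ p : ℝ, 1 < p →
      ¬ CompleteSpace (SobolevCurves.GeodesicSpace d (SobolevCurves.powerWeight (-3) p)) ∧
      ∃ c : ℕ → SobolevCurves.GeodesicSpace d (SobolevCurves.powerWeight (-3) p),
        CauchySeq c ∧ (∀ c', ¬ Tendsto c atTop (𝓝 c')) ∧
        Tendsto (fun n => SobolevCurves.curveLength (c n).curve) atTop (𝓝 0)) ∧
    (¬ ∀ a : Fin 3 → ℝ → ℝ, SobolevCurves.IsLengthWeight a →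
      max (SobolevCurves.integralZero a 1) (SobolevCurves.integralZero a 2) = ⊤ →
      max (SobolevCurves.integralInfty a 0) (max (SobolevCurves.integralInfty a 1)
        (SobolevCurves.integralInfty a 2)) = ⊤ →
      CompleteSpace (SobolevCurves.GeodesicSpace d a)) ∧
    (¬ ∀ a : Fin 3 → ℝ → ℝ, SobolevCurves.IsLengthWeight a →
      max (SobolevCurves.integralZero a 0) (max (SobolevCurves.integralZero a 1)
        (SobolevCurves.integralZero a 2)) = ⊤ →
      max (SobolevCurves.integralInfty a 1) (SobolevCurves.integralInfty a 2) = ⊤ →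
      CompleteSpace (SobolevCurves.GeodesicSpace d a)) := by
  refine ⟨fun p hp => ⟨SobolevCurves.not_completeSpace_powerWeight hd hp.ne,
      SobolevCurves.oscillatingCurve hd p, SobolevCurves.cauchySeq_oscillatingCurve hd hp.ne,
      SobolevCurves.not_tendsto_oscillatingCurve hd hp.ne,
      SobolevCurves.tendsto_curveLength_atTop hd hp⟩,
    fun p hp => ⟨SobolevCurves.not_completeSpace_powerWeight hd hp.ne',
      SobolevCurves.oscillatingCurve hd p, SobolevCurves.cauchySeq_oscillatingCurve hd hp.ne',
      SobolevCurves.not_tendsto_oscillatingCurve hd hp.ne',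
      SobolevCurves.tendsto_curveLength_zero hd hp⟩, fun h => ?_, fun h => ?_⟩
  · refine SobolevCurves.not_completeSpace_powerWeight hd (p := 0) (by norm_num)
      (h _ (SobolevCurves.isLengthWeight_powerWeight (-3) 0) ?_ ?_)
    · rw [SobolevCurves.integralZero_eq_top (k := 2) (s := 0) (fun _ => rfl) (by norm_num)]
      exact max_top_right _
    · rw [SobolevCurves.integralInfty_eq_top (k := 0) (s := -3) (fun _ => rfl) (by norm_num)]
      exact max_top_left _
  · refine SobolevCurves.not_completeSpace_powerWeight hd (p := 2) (by norm_num)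
      (h _ (SobolevCurves.isLengthWeight_powerWeight (-3) 2) ?_ ?_)
    · rw [SobolevCurves.integralZero_eq_top (k := 0) (s := -3) (fun _ => rfl) (by norm_num)]
      exact max_top_left _
    · rw [SobolevCurves.integralInfty_eq_top (k := 2) (s := 2) (fun _ => rfl) (by norm_num)]
      exact max_top_right _
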